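/- For $M\in\mathbb{R}^{2\times 2}$ and $q\in[1,\infty]$ let $|M|_q$ be the Schatten $q$-norm of $M$, i.e. the $\ell^q$-norm of the vector of its singular values. For $p\in[1,\infty]$ with conjugate exponent $p^*$ (that is, $1/p+1/p^*=1$) and $f\in L^1_{\mathrm{loc}}(\mathbb{R}^2)$, define the $p$-Hessian–Schatten variation of $f$ in $\mathbb{R}^2$ by $$|\mathrm{D}^2_p f|(\mathbb{R}^2):=\sup\Big\{\int_{\mathbb{R}^2} f\sum_{i,j=1}^2\partial_i\partial_j F_{i,j}\,dx \;:\; F\in C_c^\infty(\mathbb{R}^2)^{2\times 2},\ \sup_x|F(x)|_{p^*}\le 1\Big\}\in[0,\infty].$$ Compact support of $f$ means that $f$ vanishes almost everywhere outside some compact set, and $f(0)=1$ is understood as $\lim_{r\downarrow 0}\frac{1}{|B_r(0)|}\int_{B_r(0)}f\,dx=1$; if $f$ has a continuous representative (which is the case whenever $|\mathrm{D}^2_p f|(\mathbb{R}^2)<\infty$), this says that the continuous representative takes the value $1$ at $0$. **Lemma 4.3.** For every $p\in[1,\infty]$, $$\inf\big\{|\mathrm{D}^2_p f|(\mathbb{R}^2)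 : f\in L^1_{\mathrm{loc}}(\mathbb{R}^2)\text{ with compact support and } f(0)=1\big\}=2^{1+1/p}\pi$$ (with $1/\infty=0$). Moreover, for $p=1$ the infimum is attained by the cut cone $f^{\mathrm{cone}}(x)=(1-|x|)_+$: it belongs to the class above and $|\mathrm{D}^2_1 f^{\mathrm{cone}}|(\mathbb{R}^2)=4\pi$. -/

import Mathlib

open MeasureTheory Filter Topology
open scoped ENNReal ContDiff

namespace HessianSchatten

/-- The Schatten `p`-norm of a real square matrix, `p ∈ [1, ∞]`: the `ℓ^p` norm of the vector of its
singular values, counted with multiplicity. -/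
noncomputable def schattenNorm {d : ℕ} (p : ℝ≥0∞) (M : Matrix (Fin d) (Fin d) ℝ) : ℝ :=
  ‖WithLp.toLp p (fun i : Fin d => (Matrix.toEuclideanLin M).singularValues (i : ℕ))‖

/-- The `i`-th partial derivative of a real function on `ℝ^d`. -/
noncomputable def partialDeriv {d : ℕ} (i : Fin d) (g : EuclideanSpace ℝ (Fin d) → ℝ) :
    EuclideanSpace ℝ (Fin d) → ℝ :=
  fun x => fderiv ℝ g x (EuclideanSpace.single i 1)

/-- The double divergence `∑ i j, ∂_i ∂_j F_{i,j}` of a matrix field. -/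
noncomputable def doubleDiv {d : ℕ}
    (F : EuclideanSpace ℝ (Fin d) → Matrix (Fin d) (Fin d) ℝ) : EuclideanSpace ℝ (Fin d) → ℝ :=
  fun x => ∑ i, ∑ j, partialDeriv i (partialDeriv j (fun y => F y i j)) x

/-- The matrix fields `F ∈ C_c^∞(A)^{d × d}` with `sup_x |F(x)|_q ≤ 1` (`F` is continuous, so that
this supremum is the `L^∞` norm of `|F|_q`). -/
structure IsTestField {d : ℕ} (q : ℝ≥0∞) (A : Set (EuclideanSpace ℝ (Fin d)))
    (F : EuclideanSpace ℝ (Fin d) → Matrix (Fin d) (Fin d) ℝ) : Prop where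
  smooth : ∀ i j, ContDiff ℝ ∞ (fun x => F x i j)
  compactSupport : ∀ i j, HasCompactSupport (fun x => F x i j)
  support_subset : ∀ i j, tsupport (fun x => F x i j) ⊆ A
  norm_le : ∀ x, schattenNorm q (F x) ≤ 1

/-- The `p`-Hessian--Schatten variation `|D²_p f|(A)` of a locally integrable `f` in an open set
`A ⊆ ℝ^d`, with values in `[0, ∞]`: the supremum of `∫_A f ∑ i j, ∂_i ∂_j F_{i,j}` over the
test fields `F` for the conjugate exponent of `p`. As `F = 0` is a test field, the supremum does
not change when negative integrals are replaced by `0`. -/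
noncomputable def hessianSchattenVariation {d : ℕ} (p : ℝ≥0∞)
    (f : EuclideanSpace ℝ (Fin d) → ℝ) (A : Set (EuclideanSpace ℝ (Fin d))) : ℝ≥0∞ :=
  ⨆ (F : EuclideanSpace ℝ (Fin d) → Matrix (Fin d) (Fin d) ℝ)
    (_ : IsTestField (ENNReal.conjExponent p) A F),
    ENNReal.ofReal (∫ x in A, f x * doubleDiv F x)

/-- The value at `x` of the almost everywhere class of `f` is `c`: the mean of `f` over the ball
of radius `r` about `x` tends to `c` as `r → 0`. If the class has a continuous representative, as
it does in dimension two when its Hessian--Schatten variation is finite, this says that the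
continuous representative takes the value `c` at `x`; see `hasPointValue_iff`. -/
def HasPointValue {d : ℕ} (f : EuclideanSpace ℝ (Fin d) → ℝ) (x : EuclideanSpace ℝ (Fin d))
    (c : ℝ) : Prop :=
  Tendsto (fun r : ℝ => ⨍ y in Metric.ball x r, f y) (𝓝[>] 0) (𝓝 c)

theorem hasPointValue_iff {d : ℕ} {f g : EuclideanSpace ℝ (Fin d) → ℝ}
    (hg : Continuous g) (hfg : f =ᵐ[volume] g) (x : EuclideanSpace ℝ (Fin d)) (c : ℝ) :
    HasPointValue f x c ↔ g x = c := by
  have key : Tendsto (fun r : ℝ => ⨍ y in Metric.ball x r, f y) (𝓝[>] 0) (𝓝 (g x)) := by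
    rw [Metric.tendsto_nhds]
    intro ε hε
    obtain ⟨δ, hδ, hball⟩ := Metric.continuousAt_iff.1 hg.continuousAt (ε / 2) (by positivity)
    filter_upwards [Ioo_mem_nhdsGT hδ] with r hr
    have hpos : 0 < (volume : Measure (EuclideanSpace ℝ (Fin d))) (Metric.ball x r) :=
      Metric.measure_ball_pos _ _ hr.1
    have hfin : (volume : Measure (EuclideanSpace ℝ (Fin d))) (Metric.ball x r) ≠ ⊤ :=
      measure_ball_lt_top.ne
    have hsub : ∀ᵐ y ∂(volume.restrict (Metric.ball x r)),
        f y ∈ Metric.closedBall (g x) (ε / 2) := by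
      filter_upwards [ae_restrict_of_ae hfg, ae_restrict_mem Metric.isOpen_ball.measurableSet]
        with y hy hyr
      rw [hy]
      exact (hball (lt_trans hyr hr.2)).le
    have hint : IntegrableOn f (Metric.ball x r) := by
      have h1 : IntegrableOn g (Metric.ball x r) :=
        (hg.continuousOn.integrableOn_compact (isCompact_closedBall x r)).mono_set
          Metric.ball_subset_closedBall
      exact h1.congr (ae_restrict_of_ae hfg.symm)
    have := (convex_closedBall (g x) (ε / 2)).set_average_mem Metric.isClosed_closedBall
      hpos.ne' hfin hsub hint
    exact lt_of_le_of_lt this (by linarith)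
  exact ⟨fun h => tendsto_nhds_unique key h, fun h => h ▸ key⟩

/-- The functions `f ∈ L^1_loc(ℝ^2)` with compact (essential) support and `f(0) = 1`. -/
structure IsBump (f : EuclideanSpace ℝ (Fin 2) → ℝ) : Prop where
  locallyIntegrable : LocallyIntegrable f
  compactSupport : ∃ K : Set (EuclideanSpace ℝ (Fin 2)), IsCompact K ∧ ∀ᵐ x, x ∉ K → f x = 0
  value_zero : HasPointValue f 0 1

/-- The cut cone `x ↦ (1 - |x|)_+` on `ℝ^2`. -/
noncomputable def cutCone (x : EuclideanSpace ℝ (Fin 2)) : ℝ := max (1 - ‖x‖) 0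

end HessianSchatten

namespace HessianSchatten

section Schatten

open Matrix

variable (M : Matrix (Fin 2) (Fin 2) ℝ)

theorem adjoint_comp_toEuclideanLin :
    LinearMap.adjoint (toEuclideanLin M) ∘ₗ toEuclideanLin M = toEuclideanLin (Mᵀ * M) := by
  rw [← conjTranspose_eq_transpose_of_trivial, ← toEuclideanLin_conjTranspose_eq_adjoint]
  ext x i
  simp [Matrix.toLpLin_apply]

theorem sq_add_sq_singularValues :
    (toEuclideanLin M).singularValues 0 ^ 2 + (toEuclideanLin M).singularValues 1 ^ 2 =
      M 0 0 ^ 2 + M 0 1 ^ 2 + M 1 0 ^ 2 + M 1 1 ^ 2 := by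
  have hn : Module.finrank ℝ (EuclideanSpace ℝ (Fin 2)) = 2 := by simp
  have h := (toEuclideanLin M).isSymmetric_adjoint_comp_self.trace_eq_sum_eigenvalues hn
  simp only [Fin.sum_univ_two, ← LinearMap.sq_singularValues_fin] at h
  rw [adjoint_comp_toEuclideanLin] at h
  have h2 : LinearMap.trace ℝ _ (toEuclideanLin (Mᵀ * M)) = trace (Mᵀ * M) := by
    rw [toEuclideanLin_eq_toLin_orthonormal, trace_toLin_eq]
  rw [h2] at h
  simp [trace_fin_two, Matrix.mul_apply] at h
  linarith

theorem mul_singularValues :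
    (toEuclideanLin M).singularValues 0 * (toEuclideanLin M).singularValues 1 = |M.det| := by
  have hn : Module.finrank ℝ (EuclideanSpace ℝ (Fin 2)) = 2 := by simp
  have h := (toEuclideanLin M).isSymmetric_adjoint_comp_self.det_eq_prod_eigenvalues hn
  simp only [Fin.prod_univ_two, ← LinearMap.sq_singularValues_fin] at h
  rw [adjoint_comp_toEuclideanLin] at h
  have h2 : LinearMap.det (toEuclideanLin (Mᵀ * M)) = det (Mᵀ * M) := by
    rw [toEuclideanLin_eq_toLin_orthonormal, LinearMap.det_toLin]
  rw [h2, det_mul, det_transpose] at h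
  rw [← abs_of_nonneg (mul_nonneg ((toEuclideanLin M).singularValues_nonneg 0)
    ((toEuclideanLin M).singularValues_nonneg 1)), ← sq_eq_sq_iff_abs_eq_abs]
  simp at h
  linarith

theorem abs_quadratic_le (a b : ℝ) :
    |M 0 0 * a ^ 2 + (M 0 1 + M 1 0) * (a * b) + M 1 1 * b ^ 2| ≤
      (toEuclideanLin M).singularValues 0 * (a ^ 2 + b ^ 2) := by
  have hS := sq_add_sq_singularValues M
  have hD := mul_singularValues M
  have h01 : (toEuclideanLin M).singularValues 1 ≤ (toEuclideanLin M).singularValues 0 :=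
    (toEuclideanLin M).singularValues_antitone zero_le_one
  have h1 := (toEuclideanLin M).singularValues_nonneg 1
  set s := (toEuclideanLin M).singularValues 0
  set s' := (toEuclideanLin M).singularValues 1
  have hD2 : (s * s') ^ 2 = (M 0 0 * M 1 1 - M 0 1 * M 1 0) ^ 2 := by
    rw [hD, sq_abs, det_fin_two]
  set r := a ^ 2 + b ^ 2 with hr
  have hr0 : 0 ≤ r := by positivity
  set y := (M 0 0 * a + M 0 1 * b) ^ 2 + (M 1 0 * a + M 1 1 * b) ^ 2 with hy
  have hprod : (y - s ^ 2 * r) * (y - s' ^ 2 * r) ≤ 0 := by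
    have e : (y - s ^ 2 * r) * (y - s' ^ 2 * r) =
        y ^ 2 - (s ^ 2 + s' ^ 2) * r * y + (s * s') ^ 2 * r ^ 2 := by ring
    rw [e, hS, hD2]
    have := sq_nonneg ((M 0 0 * a + M 0 1 * b) * (M 0 0 * (-b) + M 0 1 * a) +
      (M 1 0 * a + M 1 1 * b) * (M 1 0 * (-b) + M 1 1 * a))
    rw [hy, hr]
    linarith
  have hle : y ≤ s ^ 2 * r := by
    by_contra! hlt
    have : s' ^ 2 * r ≤ s ^ 2 * r := by gcongr
    nlinarith [mul_pos (sub_pos.2 hlt) (sub_pos.2 (this.trans_lt hlt))]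
  refine abs_le_of_sq_le_sq ?_ (mul_nonneg (h1.trans h01) hr0)
  calc _ ≤ r * y := by
        rw [hy, hr]
        nlinarith [sq_nonneg (a * (M 1 0 * a + M 1 1 * b) - b * (M 0 0 * a + M 0 1 * b))]
    _ ≤ r * (s ^ 2 * r) := by gcongr
    _ = _ := by ring

theorem abs_reflection_le (a b : ℝ) :
    |(M 0 0 - M 1 1) * (b ^ 2 - a ^ 2) - 2 * (M 0 1 + M 1 0) * (a * b)| ≤
      ((toEuclideanLin M).singularValues 0 + (toEuclideanLin M).singularValues 1) *
        (a ^ 2 + b ^ 2) := by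
  have hS := sq_add_sq_singularValues M
  have hD := mul_singularValues M
  have h0 := (toEuclideanLin M).singularValues_nonneg 0
  have h1 := (toEuclideanLin M).singularValues_nonneg 1
  set s := (toEuclideanLin M).singularValues 0
  set s' := (toEuclideanLin M).singularValues 1
  refine abs_le_of_sq_le_sq ?_ (by positivity)
  have hdet : -(M 0 0 * M 1 1 - M 0 1 * M 1 0) ≤ s * s' := by
    rw [hD, det_fin_two]; exact neg_le_abs _
  have h2 : (M 0 0 - M 1 1) ^ 2 + (M 0 1 + M 1 0) ^ 2 ≤ (s + s') ^ 2 := by nlinarith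
  calc _ ≤ ((M 0 0 - M 1 1) ^ 2 + (M 0 1 + M 1 0) ^ 2) * (a ^ 2 + b ^ 2) ^ 2 := by
        nlinarith [sq_nonneg ((M 0 0 - M 1 1) * (2 * (a * b)) +
          (M 0 1 + M 1 0) * (b ^ 2 - a ^ 2))]
    _ ≤ (s + s') ^ 2 * (a ^ 2 + b ^ 2) ^ 2 := by gcongr
    _ = _ := by ring

theorem singularValues_zero_le_schattenNorm {q : ℝ≥0∞} (hq : 1 ≤ q) :
    (toEuclideanLin M).singularValues 0 ≤ schattenNorm q M := by
  have : Fact (1 ≤ q) := ⟨hq⟩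
  have := PiLp.norm_apply_le (WithLp.toLp q
    (fun i : Fin 2 => (toEuclideanLin M).singularValues (i : ℕ))) 0
  exact (le_abs_self _).trans this

theorem add_singularValues_le_schattenNorm {q : ℝ≥0∞} (hq : 1 ≤ q) :
    (toEuclideanLin M).singularValues 0 + (toEuclideanLin M).singularValues 1 ≤
      2 ^ (1 - (q⁻¹).toReal) * schattenNorm q M := by
  have h0 := (toEuclideanLin M).singularValues_nonneg 0
  have h1 := (toEuclideanLin M).singularValues_nonneg 1
  rcases eq_or_ne q ∞ with rfl | hq'
  · have h := singularValues_zero_le_schattenNorm M hq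
    have h01 : (toEuclideanLin M).singularValues 1 ≤ (toEuclideanLin M).singularValues 0 :=
      (toEuclideanLin M).singularValues_antitone zero_le_one
    simp
    linarith
  · have hq1 : 1 ≤ q.toReal := by
      simpa using ENNReal.toReal_mono hq' hq
    have hq0 : 0 < q.toReal := zero_lt_one.trans_le hq1
    have key : ((toEuclideanLin M).singularValues 0 + (toEuclideanLin M).singularValues 1) ^ q.toReal
        ≤ 2 ^ (q.toReal - 1) * ((toEuclideanLin M).singularValues 0 ^ q.toReal +
          (toEuclideanLin M).singularValues 1 ^ q.toReal) := by
      lift (toEuclideanLin M).singularValues 0 to NNReal using h0 with s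
      lift (toEuclideanLin M).singularValues 1 to NNReal using h1 with s'
      exact_mod_cast NNReal.rpow_add_le_mul_rpow_add_rpow s s' hq1
    rw [schattenNorm, PiLp.norm_eq_sum hq0, Fin.sum_univ_two, ENNReal.toReal_inv]
    simp only [Real.norm_eq_abs, Fin.val_zero, Fin.val_one, abs_of_nonneg h0, abs_of_nonneg h1]
    have h2 := Real.rpow_le_rpow (by positivity) key (inv_nonneg.2 hq0.le)
    rw [Real.rpow_rpow_inv (by positivity) hq0.ne',
      Real.mul_rpow (by positivity) (by positivity), ← Real.rpow_mul (by norm_num)] at h2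
    rw [sub_mul, mul_inv_cancel₀ hq0.ne', one_mul] at h2
    rwa [one_div]

theorem schattenNorm_of_singularValues_eq {q : ℝ≥0∞} (hq : 1 ≤ q) {s : ℝ} (hs : 0 ≤ s)
    (hS : M 0 0 ^ 2 + M 0 1 ^ 2 + M 1 0 ^ 2 + M 1 1 ^ 2 = 2 * s ^ 2) (hD : |M.det| = s ^ 2) :
    schattenNorm q M = 2 ^ (q⁻¹).toReal * s := by
  have : Fact (1 ≤ q) := ⟨hq⟩
  have h0 := (toEuclideanLin M).singularValues_nonneg 0
  have h1 := (toEuclideanLin M).singularValues_nonneg 1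
  have hS' := sq_add_sq_singularValues M
  have hD' := mul_singularValues M
  have e01 : (toEuclideanLin M).singularValues 0 = (toEuclideanLin M).singularValues 1 := by
    have : ((toEuclideanLin M).singularValues 0 - (toEuclideanLin M).singularValues 1) ^ 2 = 0 := by
      linarith
    exact sub_eq_zero.1 (pow_eq_zero_iff two_ne_zero |>.1 this)
  have e0 : (toEuclideanLin M).singularValues 0 = s := by
    rw [← abs_of_nonneg h0, ← abs_of_nonneg hs, ← sq_eq_sq_iff_abs_eq_abs]
    rw [← e01] at hS'
    linarith
  have : (fun i : Fin 2 => (toEuclideanLin M).singularValues (i : ℕ)) = Function.const _ s := by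
    ext i
    fin_cases i
    · exact e0
    · exact e01.symm.trans e0
  rw [schattenNorm, this, PiLp.norm_toLp_const']
  simp [abs_of_nonneg hs]

end Schatten
section Calculus

variable {d : ℕ}

theorem HasFDerivAt.partialDeriv_eq {g : EuclideanSpace ℝ (Fin d) → ℝ}
    {g' : EuclideanSpace ℝ (Fin d) →L[ℝ] ℝ} {x : EuclideanSpace ℝ (Fin d)}
    (h : HasFDerivAt g g' x) (i : Fin d) :
    partialDeriv i g x = g' (EuclideanSpace.single i 1) := by
  rw [partialDeriv, h.fderiv]

theorem hasFDerivAt_coord (j : Fin d) (x : EuclideanSpace ℝ (Fin d)) :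
    HasFDerivAt (fun y : EuclideanSpace ℝ (Fin d) => y j)
      (EuclideanSpace.proj j : EuclideanSpace ℝ (Fin d) →L[ℝ] ℝ) x :=
  (EuclideanSpace.proj j : EuclideanSpace ℝ (Fin d) →L[ℝ] ℝ).hasFDerivAt

theorem partialDeriv_coord (i j : Fin d) (x : EuclideanSpace ℝ (Fin d)) :
    partialDeriv i (fun y => y j) x = if j = i then 1 else 0 := by
  rw [HasFDerivAt.partialDeriv_eq (hasFDerivAt_coord j x)]
  simp

theorem partialDeriv_add {f g : EuclideanSpace ℝ (Fin d) → ℝ} (hf : Differentiable ℝ f)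
    (hg : Differentiable ℝ g) (i : Fin d) (x : EuclideanSpace ℝ (Fin d)) :
    partialDeriv i (fun y => f y + g y) x = partialDeriv i f x + partialDeriv i g x := by
  exact HasFDerivAt.partialDeriv_eq ((hf x).hasFDerivAt.add (hg x).hasFDerivAt) i

theorem partialDeriv_sub {f g : EuclideanSpace ℝ (Fin d) → ℝ} (hf : Differentiable ℝ f)
    (hg : Differentiable ℝ g) (i : Fin d) (x : EuclideanSpace ℝ (Fin d)) :
    partialDeriv i (fun y => f y - g y) x = partialDeriv i f x - partialDeriv i g x := by
  exact HasFDerivAt.partialDeriv_eq ((hf x).hasFDerivAt.sub (hg x).hasFDerivAt) i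

theorem partialDeriv_mul {f g : EuclideanSpace ℝ (Fin d) → ℝ} (hf : Differentiable ℝ f)
    (hg : Differentiable ℝ g) (i : Fin d) (x : EuclideanSpace ℝ (Fin d)) :
    partialDeriv i (fun y => f y * g y) x =
      partialDeriv i f x * g x + f x * partialDeriv i g x := by
  refine (HasFDerivAt.partialDeriv_eq ((hf x).hasFDerivAt.mul (hg x).hasFDerivAt) i).trans ?_
  simp [partialDeriv]
  ring

theorem partialDeriv_const (c : ℝ) (i : Fin d) (x : EuclideanSpace ℝ (Fin d)) :
    partialDeriv i (fun _ => c) x = 0 := by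
  simp [partialDeriv]

theorem partialDeriv_comp_norm_sq {φ : ℝ → ℝ} (hφ : Differentiable ℝ φ) (i : Fin d)
    (x : EuclideanSpace ℝ (Fin d)) :
    partialDeriv i (fun y => φ (‖y‖ ^ 2)) x = deriv φ (‖x‖ ^ 2) * (2 * x i) := by
  have h : HasFDerivAt (fun y : EuclideanSpace ℝ (Fin d) => ‖y‖ ^ 2) _ x :=
    (hasStrictFDerivAt_norm_sq x).hasFDerivAt
  refine (HasFDerivAt.partialDeriv_eq ((hφ _).hasDerivAt.comp_hasFDerivAt x h) i).trans ?_
  simp [EuclideanSpace.inner_single_right]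

theorem contDiff_partialDeriv {g : EuclideanSpace ℝ (Fin d) → ℝ} (hg : ContDiff ℝ ∞ g)
    (i : Fin d) : ContDiff ℝ ∞ (partialDeriv i g) :=
  (hg.fderiv_right (m := ∞) le_rfl).clm_apply contDiff_const

theorem support_partialDeriv_subset (g : EuclideanSpace ℝ (Fin d) → ℝ) (i : Fin d) :
    Function.support (partialDeriv i g) ⊆ tsupport g := by
  refine fun x hx => support_fderiv_subset ℝ (f := g) fun h => hx ?_
  simp [partialDeriv, h]

theorem hasCompactSupport_partialDeriv {g : EuclideanSpace ℝ (Fin d) → ℝ}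
    (hg : HasCompactSupport g) (i : Fin d) : HasCompactSupport (partialDeriv i g) :=
  hg.mono' (support_partialDeriv_subset g i)

theorem integral_mul_partialDeriv {f g : EuclideanSpace ℝ (Fin d) → ℝ} (hf : ContDiff ℝ ∞ f)
    (hg : ContDiff ℝ ∞ g) (hgc : HasCompactSupport g) (i : Fin d) :
    ∫ x, f x * partialDeriv i g x = -∫ x, partialDeriv i f x * g x := by
  have hf1 := (contDiff_partialDeriv hf i).continuous
  have hg1 := (contDiff_partialDeriv hg i).continuous
  exact integral_mul_fderiv_eq_neg_fderiv_mul_of_integrable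
    ((hf1.mul hg.continuous).integrable_of_hasCompactSupport hgc.mul_left)
    ((hf.continuous.mul hg1).integrable_of_hasCompactSupport
      (hasCompactSupport_partialDeriv hgc i).mul_left)
    ((hf.continuous.mul hg.continuous).integrable_of_hasCompactSupport hgc.mul_left)
    (fun x _ => hf.differentiable (by simp) x) (fun x _ => hg.differentiable (by simp) x)

theorem integral_mul_partialDeriv_partialDeriv {f g : EuclideanSpace ℝ (Fin d) → ℝ}
    (hf : ContDiff ℝ ∞ f) (hg : ContDiff ℝ ∞ g) (hgc : HasCompactSupport g) (i j : Fin d) :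
    ∫ x, f x * partialDeriv i (partialDeriv j g) x =
      ∫ x, partialDeriv j (partialDeriv i f) x * g x := by
  rw [integral_mul_partialDeriv hf (contDiff_partialDeriv hg j)
    (hasCompactSupport_partialDeriv hgc j), integral_mul_partialDeriv
    (contDiff_partialDeriv hf i) hg hgc, neg_neg]

theorem integral_mul_doubleDiv {f : EuclideanSpace ℝ (Fin d) → ℝ} (hf : ContDiff ℝ ∞ f)
    {q : ℝ≥0∞} {A : Set (EuclideanSpace ℝ (Fin d))}
    {F : EuclideanSpace ℝ (Fin d) → Matrix (Fin d) (Fin d) ℝ} (hF : IsTestField q A F) :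
    ∫ x, f x * doubleDiv F x =
      ∫ x, ∑ i, ∑ j, partialDeriv j (partialDeriv i f) x * F x i j := by
  have h1 (i j : Fin d) : Integrable fun x =>
      f x * partialDeriv i (partialDeriv j fun y => F y i j) x :=
    (hf.continuous.mul (contDiff_partialDeriv (contDiff_partialDeriv (hF.smooth i j) j)
      i).continuous).integrable_of_hasCompactSupport (hasCompactSupport_partialDeriv
        (hasCompactSupport_partialDeriv (hF.compactSupport i j) j) i).mul_left
  have h2 (i j : Fin d) : Integrable fun x => partialDeriv j (partialDeriv i f) x * F x i j :=
    ((contDiff_partialDeriv (contDiff_partialDeriv hf i) j).continuous.mul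
      (hF.smooth i j).continuous).integrable_of_hasCompactSupport (hF.compactSupport i j).mul_left
  simp only [doubleDiv, Finset.mul_sum]
  rw [integral_finsetSum _ fun i _ => integrable_finsetSum _ fun j _ => h1 i j,
    integral_finsetSum _ fun i _ => integrable_finsetSum _ fun j _ => h2 i j]
  refine Finset.sum_congr rfl fun i _ => ?_
  rw [integral_finsetSum _ fun j _ => h1 i j, integral_finsetSum _ fun j _ => h2 i j]
  exact Finset.sum_congr rfl fun j _ =>
    integral_mul_partialDeriv_partialDeriv hf (hF.smooth i j) (hF.compactSupport i j) i j

theorem contDiff_deriv_infty {φ : ℝ → ℝ} (hφ : ContDiff ℝ ∞ φ) : ContDiff ℝ ∞ (deriv φ) :=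
  (contDiff_infty_iff_deriv.1 hφ).2

theorem contDiff_comp_norm_sq {φ : ℝ → ℝ} (hφ : ContDiff ℝ ∞ φ) :
    ContDiff ℝ ∞ fun x : EuclideanSpace ℝ (Fin d) => φ (‖x‖ ^ 2) :=
  hφ.comp (contDiff_norm_sq ℝ)

theorem contDiff_coord (j : Fin d) : ContDiff ℝ ∞ fun x : EuclideanSpace ℝ (Fin d) => x j :=
  (EuclideanSpace.proj j : EuclideanSpace ℝ (Fin d) →L[ℝ] ℝ).contDiff

theorem partialDeriv_partialDeriv_comp_norm_sq {φ : ℝ → ℝ} (hφ : ContDiff ℝ ∞ φ) (i j : Fin d)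
    (x : EuclideanSpace ℝ (Fin d)) :
    partialDeriv i (partialDeriv j fun y => φ (‖y‖ ^ 2)) x =
      4 * deriv (deriv φ) (‖x‖ ^ 2) * (x i * x j) +
        2 * deriv φ (‖x‖ ^ 2) * (if j = i then 1 else 0) := by
  have hd : Differentiable ℝ fun y : EuclideanSpace ℝ (Fin d) => y j :=
    (contDiff_coord j).differentiable (by simp)
  have hφ' := contDiff_deriv_infty hφ
  have e : (partialDeriv j fun y : EuclideanSpace ℝ (Fin d) => φ (‖y‖ ^ 2)) =
      fun y => deriv φ (‖y‖ ^ 2) * (2 * y j) := by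
    ext y
    exact partialDeriv_comp_norm_sq (hφ.differentiable (by simp)) j y
  rw [e, partialDeriv_mul ((contDiff_comp_norm_sq hφ').differentiable (by simp))
    (hd.const_mul 2), partialDeriv_comp_norm_sq (hφ'.differentiable (by simp)),
    partialDeriv_mul (differentiable_const _) hd, partialDeriv_const, partialDeriv_coord]
  ring

end Calculus

section Plane

/-- The matrix field `b(|x|²) (2 x ⊗ x - |x|² I)` on the plane. -/
noncomputable def reflectionField (b : ℝ → ℝ) (x : EuclideanSpace ℝ (Fin 2)) :
    Matrix (Fin 2) (Fin 2) ℝ :=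
  !![b (‖x‖ ^ 2) * (x 0 * x 0 - x 1 * x 1), b (‖x‖ ^ 2) * (2 * (x 0 * x 1));
    b (‖x‖ ^ 2) * (2 * (x 0 * x 1)), b (‖x‖ ^ 2) * (x 1 * x 1 - x 0 * x 0)]

theorem norm_sq_fin_two (x : EuclideanSpace ℝ (Fin 2)) : ‖x‖ ^ 2 = x 0 ^ 2 + x 1 ^ 2 := by
  simp [EuclideanSpace.norm_sq_eq]

theorem partialDeriv_comp_norm_sq_mul {d : ℕ} {φ : ℝ → ℝ} (hφ : ContDiff ℝ ∞ φ)
    {Q : EuclideanSpace ℝ (Fin d) → ℝ} (hQ : ContDiff ℝ ∞ Q) (i : Fin d) :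
    (partialDeriv i fun y => φ (‖y‖ ^ 2) * Q y) =
      fun x => deriv φ (‖x‖ ^ 2) * (2 * x i * Q x) + φ (‖x‖ ^ 2) * partialDeriv i Q x := by
  ext x
  rw [partialDeriv_mul ((contDiff_comp_norm_sq hφ).differentiable (by simp))
    (hQ.differentiable (by simp)), partialDeriv_comp_norm_sq (hφ.differentiable (by simp))]
  ring

theorem partialDeriv_partialDeriv_comp_norm_sq_mul {d : ℕ} {φ : ℝ → ℝ} (hφ : ContDiff ℝ ∞ φ)
    {Q : EuclideanSpace ℝ (Fin d) → ℝ} (hQ : ContDiff ℝ ∞ Q) (i j : Fin d)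
    (x : EuclideanSpace ℝ (Fin d)) :
    partialDeriv i (partialDeriv j fun y => φ (‖y‖ ^ 2) * Q y) x =
      deriv (deriv φ) (‖x‖ ^ 2) * (4 * x i * x j * Q x) +
      2 * deriv φ (‖x‖ ^ 2) * ((if j = i then 1 else 0) * Q x + x j * partialDeriv i Q x +
        x i * partialDeriv j Q x) +
      φ (‖x‖ ^ 2) * partialDeriv i (partialDeriv j Q) x := by
  have hφ' := contDiff_deriv_infty hφ
  have hj : ContDiff ℝ ∞ fun y : EuclideanSpace ℝ (Fin d) => 2 * y j :=
    contDiff_const.mul (contDiff_coord j)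
  have hQ' := contDiff_partialDeriv hQ j
  rw [partialDeriv_comp_norm_sq_mul hφ hQ, partialDeriv_add
    (((contDiff_comp_norm_sq hφ').mul (hj.mul hQ)).differentiable (by simp))
    (((contDiff_comp_norm_sq hφ).mul hQ').differentiable (by simp)),
    partialDeriv_comp_norm_sq_mul hφ' (hj.mul hQ), partialDeriv_comp_norm_sq_mul hφ hQ']
  beta_reduce
  rw [partialDeriv_mul (hj.differentiable (by simp)) (hQ.differentiable (by simp)),
    partialDeriv_mul (differentiable_const _) ((contDiff_coord j).differentiable (by simp)),
    partialDeriv_const, partialDeriv_coord]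
  ring

theorem partialDeriv_coord_mul_coord {d : ℕ} (i j k : Fin d) :
    (partialDeriv i fun y : EuclideanSpace ℝ (Fin d) => y j * y k) =
      fun x => (if j = i then 1 else 0) * x k + (if k = i then 1 else 0) * x j := by
  ext x
  have hd (l : Fin d) : Differentiable ℝ fun y : EuclideanSpace ℝ (Fin d) => y l :=
    (contDiff_coord l).differentiable (by simp)
  rw [partialDeriv_mul (hd j) (hd k), partialDeriv_coord, partialDeriv_coord]
  ring

theorem doubleDiv_reflectionField {b : ℝ → ℝ} (hb : ContDiff ℝ ∞ b)
    (x : EuclideanSpace ℝ (Fin 2)) :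
    doubleDiv (reflectionField b) x = 8 * deriv (fun t => t * b t) (‖x‖ ^ 2) +
      4 * ‖x‖ ^ 2 * deriv (deriv fun t => t * b t) (‖x‖ ^ 2) := by
  have hb' := contDiff_deriv_infty hb
  have hc (j : Fin 2) : ContDiff ℝ ∞ fun y : EuclideanSpace ℝ (Fin 2) => y j := contDiff_coord j
  have hd (j : Fin 2) : Differentiable ℝ fun y : EuclideanSpace ℝ (Fin 2) => y j :=
    (contDiff_coord j).differentiable (by simp)
  have e1 : deriv (fun t => t * b t) = fun t => b t + t * deriv b t := by
    ext t
    have := (hasDerivAt_id t).mul (hb.differentiable (by simp) t).hasDerivAt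
    simpa using! this.deriv
  have e2 (t : ℝ) : deriv (fun t => b t + t * deriv b t) t =
      2 * deriv b t + t * deriv (deriv b) t := by
    have := (hb.differentiable (by simp) t).hasDerivAt.add
      ((hasDerivAt_id t).mul (hb'.differentiable (by simp) t).hasDerivAt)
    have h2 := this.deriv
    simp only [id_eq, one_mul] at h2
    refine Eq.trans ?_ (h2.trans (by ring))
    rfl
  rw [e1, e2]
  have hm (j k : Fin 2) : Differentiable ℝ fun y : EuclideanSpace ℝ (Fin 2) => y j * y k :=
    (hd j).mul (hd k)
  have hd2 (i k : Fin 2) : partialDeriv i (fun y : EuclideanSpace ℝ (Fin 2) => 2 * y k) x =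
      2 * (if k = i then 1 else 0) := by
    rw [partialDeriv_mul (differentiable_const _) (hd k), partialDeriv_const, partialDeriv_coord]
    ring
  have q1 : (partialDeriv 0 fun y : EuclideanSpace ℝ (Fin 2) => y 0 * y 0 - y 1 * y 1) =
      fun y => 2 * y 0 := by
    ext y
    rw [partialDeriv_sub (hm 0 0) (hm 1 1), partialDeriv_coord_mul_coord,
      partialDeriv_coord_mul_coord]
    simp; ring
  have q2 : (partialDeriv 1 fun y : EuclideanSpace ℝ (Fin 2) => y 1 * y 1 - y 0 * y 0) =
      fun y => 2 * y 1 := by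
    ext y
    rw [partialDeriv_sub (hm 1 1) (hm 0 0), partialDeriv_coord_mul_coord,
      partialDeriv_coord_mul_coord]
    simp; ring
  have q3 : (partialDeriv 0 fun y : EuclideanSpace ℝ (Fin 2) => 2 * (y 0 * y 1)) =
      fun y => 2 * y 1 := by
    ext y
    rw [partialDeriv_mul (differentiable_const _) (hm 0 1), partialDeriv_const,
      partialDeriv_coord_mul_coord]
    simp
  have q4 : (partialDeriv 1 fun y : EuclideanSpace ℝ (Fin 2) => 2 * (y 0 * y 1)) =
      fun y => 2 * y 0 := by
    ext y
    rw [partialDeriv_mul (differentiable_const _) (hm 0 1), partialDeriv_const,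
      partialDeriv_coord_mul_coord]
    simp
  simp only [doubleDiv, Fin.sum_univ_two, reflectionField, Matrix.of_apply, Matrix.cons_val',
    Matrix.cons_val_zero, Matrix.cons_val_one, Matrix.cons_val_fin_one]
  rw [partialDeriv_partialDeriv_comp_norm_sq_mul hb (((hc 0).mul (hc 0)).sub ((hc 1).mul (hc 1))),
    partialDeriv_partialDeriv_comp_norm_sq_mul hb (contDiff_const.mul ((hc 0).mul (hc 1))),
    partialDeriv_partialDeriv_comp_norm_sq_mul hb (contDiff_const.mul ((hc 0).mul (hc 1))),
    partialDeriv_partialDeriv_comp_norm_sq_mul hb (((hc 1).mul (hc 1)).sub ((hc 0).mul (hc 0))),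
    q1, q2, q3, q4, hd2, hd2, norm_sq_fin_two]
  simp
  ring

end Plane
section LayerCake

theorem ball_eq_of_sq {d : ℕ} {ε t : ℝ} (hε : 0 < ε) (ht : 0 < t) :
    {x : EuclideanSpace ℝ (Fin d) | (ε ^ 2)⁻¹ * ‖x‖ ^ 2 < t} = Metric.ball 0 (ε * √t) := by
  ext x
  have h : ε ^ 2 * t = (ε * √t) ^ 2 := by rw [mul_pow, Real.sq_sqrt ht.le]
  rw [Set.mem_ofPred_eq, mem_ball_zero_iff, inv_mul_lt_iff₀ (by positivity), h,
    sq_lt_sq₀ (norm_nonneg x) (by positivity)]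

theorem integral_deriv_indicator {Ψ : ℝ → ℝ} (hΨ : ContDiff ℝ ∞ Ψ) {L : ℝ}
    (hL : ∀ t, L ≤ t → Ψ t = 0) {s : ℝ} (hs : 0 ≤ s) :
    ∫ t in Set.Ioc 0 L, (Set.Ioi s).indicator (fun t => -deriv Ψ t) t = Ψ s := by
  rw [integral_indicator measurableSet_Ioi, Measure.restrict_restrict measurableSet_Ioi,
    integral_neg]
  rcases le_total L s with h | h
  · have : Set.Ioi s ∩ Set.Ioc 0 L = ∅ := by
      ext t
      simp only [Set.mem_inter_iff, Set.mem_Ioi, Set.mem_Ioc, Set.mem_empty_iff_false]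
      grind
    simp [this, hL s h]
  · have : Set.Ioi s ∩ Set.Ioc 0 L = Set.Ioc s L := by
      ext t
      simp only [Set.mem_inter_iff, Set.mem_Ioi, Set.mem_Ioc]
      grind
    rw [this, ← intervalIntegral.integral_of_le h,
      intervalIntegral.integral_deriv_eq_sub
        (fun t _ => hΨ.differentiable (by simp) t)
        ((contDiff_deriv_infty hΨ).continuous.intervalIntegrable _ _), hL L le_rfl]
    ring

theorem integrable_layerCake {d : ℕ} {f : EuclideanSpace ℝ (Fin d) → ℝ} (hf : Integrable f)
    {Ψ : ℝ → ℝ} (hΨ : ContDiff ℝ ∞ Ψ) (L a : ℝ) :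
    Integrable (fun z : ℝ × EuclideanSpace ℝ (Fin d) =>
      {z : ℝ × EuclideanSpace ℝ (Fin d) | a * ‖z.2‖ ^ 2 < z.1}.indicator
        (fun z => -deriv Ψ z.1 * f z.2) z) ((volume.restrict (Set.Ioc 0 L)).prod volume) := by
  have h1 : Integrable (fun t => -deriv Ψ t) (volume.restrict (Set.Ioc 0 L)) :=
    ((contDiff_deriv_infty hΨ).continuous.neg.integrableOn_Icc).mono_set Set.Ioc_subset_Icc_self
  refine (h1.mul_prod hf).indicator ?_
  exact measurableSet_lt (by fun_prop) (by fun_prop)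

theorem integral_mul_comp_norm_sq {d : ℕ} {f : EuclideanSpace ℝ (Fin d) → ℝ} (hf : Integrable f)
    {Ψ : ℝ → ℝ} (hΨ : ContDiff ℝ ∞ Ψ) {L : ℝ} (hL : ∀ t, L ≤ t → Ψ t = 0) {ε : ℝ} (hε : 0 < ε) :
    ∫ x, f x * Ψ ((ε ^ 2)⁻¹ * ‖x‖ ^ 2) =
      ∫ t in Set.Ioc 0 L, -deriv Ψ t * ∫ x in Metric.ball 0 (ε * √t), f x := by
  have hswap := integral_integral_swap (μ := volume.restrict (Set.Ioc 0 L)) (ν := volume)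
    (f := fun (t : ℝ) (x : EuclideanSpace ℝ (Fin d)) =>
      {z : ℝ × EuclideanSpace ℝ (Fin d) | (ε ^ 2)⁻¹ * ‖z.2‖ ^ 2 < z.1}.indicator
        (fun z => -deriv Ψ z.1 * f z.2) (t, x)) (integrable_layerCake hf hΨ L (ε ^ 2)⁻¹)
  have e1 : ∀ x, ∫ t in Set.Ioc 0 L,
      {z : ℝ × EuclideanSpace ℝ (Fin d) | (ε ^ 2)⁻¹ * ‖z.2‖ ^ 2 < z.1}.indicator
        (fun z => -deriv Ψ z.1 * f z.2) (t, x) = f x * Ψ ((ε ^ 2)⁻¹ * ‖x‖ ^ 2) := by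
    intro x
    rw [← integral_deriv_indicator hΨ hL (s := (ε ^ 2)⁻¹ * ‖x‖ ^ 2) (by positivity),
      ← integral_const_mul]
    congr 1
    ext t
    simp only [Set.indicator_apply, Set.mem_ofPred_eq, Set.mem_Ioi]
    split_ifs <;> ring
  simp only [e1] at hswap
  rw [← hswap]
  refine setIntegral_congr_fun measurableSet_Ioc fun t ht => ?_
  beta_reduce
  rw [← integral_const_mul, ← ball_eq_of_sq hε ht.1,
    ← integral_indicator (measurableSet_lt (by fun_prop) (by fun_prop))]
  congr 1

theorem aestronglyMeasurable_deriv_mul_setIntegral_ball {d : ℕ}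
    {f : EuclideanSpace ℝ (Fin d) → ℝ} (hf : Integrable f)
    {Ψ : ℝ → ℝ} (hΨ : ContDiff ℝ ∞ Ψ) (L : ℝ) {ε : ℝ} (hε : 0 < ε) :
    AEStronglyMeasurable (fun t => -deriv Ψ t * ∫ x in Metric.ball 0 (ε * √t), f x)
      (volume.restrict (Set.Ioc 0 L)) := by
  refine (integrable_layerCake hf hΨ L (ε ^ 2)⁻¹).integral_prod_left.aestronglyMeasurable.congr ?_
  refine (ae_restrict_iff' measurableSet_Ioc).2 (Eventually.of_forall fun t ht => ?_)
  beta_reduce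
  rw [← integral_const_mul, ← ball_eq_of_sq hε ht.1,
    ← integral_indicator (measurableSet_lt (by fun_prop) (by fun_prop))]
  congr 1

theorem setIntegral_ball_eq {f : EuclideanSpace ℝ (Fin 2) → ℝ} {r : ℝ} (hr : 0 < r) :
    ∫ x in Metric.ball 0 r, f x = Real.pi * r ^ 2 * ⨍ x in Metric.ball 0 r, f x := by
  have : volume.real (Metric.ball (0 : EuclideanSpace ℝ (Fin 2)) r) = Real.pi * r ^ 2 := by
    rw [Measure.real, EuclideanSpace.volume_ball_fin_two]
    simp [hr.le, mul_comm, Real.pi_pos.le]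
  rw [setAverage_eq, this, smul_eq_mul, mul_inv_cancel_left₀ (by positivity)]

/-- Radial test functions, rescaled about a point where `f` has a value, see only that value. -/
theorem tendsto_integral_mul_comp_norm_sq {f : EuclideanSpace ℝ (Fin 2) → ℝ} (hf : Integrable f)
    {c : ℝ} (hc : HasPointValue f 0 c)
    {Ψ : ℝ → ℝ} (hΨ : ContDiff ℝ ∞ Ψ) {L : ℝ} (hL : ∀ t, L ≤ t → Ψ t = 0) :
    Tendsto (fun ε : ℝ => (ε ^ 2)⁻¹ * ∫ x, f x * Ψ ((ε ^ 2)⁻¹ * ‖x‖ ^ 2)) (𝓝[>] 0)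
      (𝓝 (c * Real.pi * ∫ t in Set.Ioc 0 L, -deriv Ψ t * t)) := by
  have key : Tendsto (fun ε : ℝ => ∫ t in Set.Ioc 0 L,
      (ε ^ 2)⁻¹ * (-deriv Ψ t * ∫ x in Metric.ball 0 (ε * √t), f x)) (𝓝[>] 0)
      (𝓝 (∫ t in Set.Ioc 0 L, c * Real.pi * (-deriv Ψ t * t))) := by
    have hscale (t : ℝ) (ht : 0 < t) : ∀ ε : ℝ, 0 < ε →
        (ε ^ 2)⁻¹ * (-deriv Ψ t * ∫ x in Metric.ball 0 (ε * √t), f x) =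
          (⨍ x in Metric.ball 0 (ε * √t), f x) * Real.pi * (-deriv Ψ t * t) := by
      intro ε hε
      rw [setIntegral_ball_eq (by positivity), mul_pow, Real.sq_sqrt ht.le]
      field_simp
    obtain ⟨ρ, hρ, hb⟩ : ∃ ρ > 0, ∀ r ∈ Set.Ioo 0 ρ,
        |⨍ x in Metric.ball (0 : EuclideanSpace ℝ (Fin 2)) r, f x| ≤ |c| + 1 := by
      have := hc.abs.eventually (eventually_le_nhds (lt_add_one |c|))
      obtain ⟨ρ, hρ, h⟩ := mem_nhdsGT_iff_exists_Ioo_subset.1 this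
      exact ⟨ρ, hρ, fun r hr => h hr⟩
    refine tendsto_integral_filter_of_dominated_convergence
      (fun t => (|c| + 1) * Real.pi * (|deriv Ψ t| * t)) ?_ ?_ ?_ ?_
    · filter_upwards [self_mem_nhdsWithin] with ε hε
      exact (aestronglyMeasurable_deriv_mul_setIntegral_ball hf hΨ L hε).const_mul _
    · have hpos : 0 < ρ / (√L + 1) := by positivity
      filter_upwards [Ioo_mem_nhdsGT hpos] with ε hε
      refine (ae_restrict_iff' measurableSet_Ioc).2 (Eventually.of_forall fun t ht => ?_)
      have h1 : ε * √t < ρ := by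
        have := (lt_div_iff₀ (by positivity)).1 hε.2
        have h2 : √t ≤ √L + 1 := (Real.sqrt_le_sqrt ht.2).trans (by linarith)
        exact (mul_le_mul_of_nonneg_left h2 hε.1.le).trans_lt this
      have h3 : 0 < ε * √t := mul_pos hε.1 (Real.sqrt_pos.2 ht.1)
      rw [hscale t ht.1 ε hε.1, Real.norm_eq_abs, abs_mul, abs_mul, abs_mul, abs_neg,
        abs_of_pos Real.pi_pos, abs_of_pos ht.1]
      have := hb _ ⟨h3, h1⟩
      have ht0 := ht.1.le
      gcongr
    · have : Continuous fun t => (|c| + 1) * Real.pi * (|deriv Ψ t| * t) := by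
        have := (contDiff_deriv_infty hΨ).continuous
        fun_prop
      exact this.integrableOn_Icc.mono_set Set.Ioc_subset_Icc_self
    · refine (ae_restrict_iff' measurableSet_Ioc).2 (Eventually.of_forall fun t ht => ?_)
      have h1 : Tendsto (fun ε : ℝ => ε * √t) (𝓝[>] 0) (𝓝[>] 0) := by
        refine tendsto_nhdsWithin_iff.2 ⟨?_, ?_⟩
        · have : Tendsto (fun ε : ℝ => ε * √t) (𝓝 0) (𝓝 (0 * √t)) :=
            (continuous_id.mul continuous_const).tendsto 0
          rw [zero_mul] at this
          exact this.mono_left nhdsWithin_le_nhds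
        · filter_upwards [self_mem_nhdsWithin] with ε hε
          exact mul_pos hε (Real.sqrt_pos.2 ht.1)
      refine Tendsto.congr' ?_ (((hc.comp h1).mul_const Real.pi).mul_const (-deriv Ψ t * t))
      filter_upwards [self_mem_nhdsWithin] with ε hε
      exact (hscale t ht.1 ε hε).symm
  rw [integral_const_mul] at key
  refine key.congr' ?_
  filter_upwards [self_mem_nhdsWithin] with ε hε
  rw [integral_const_mul, integral_mul_comp_norm_sq hf hΨ hL hε]

end LayerCake
section LowerBound

/-- A smooth step from `0` on `(-∞, 1]` to `1` on `[2, ∞)`. -/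
noncomputable def smoothStep (t : ℝ) : ℝ := Real.smoothTransition (t - 1)

theorem contDiff_smoothStep : ContDiff ℝ ∞ smoothStep :=
  Real.smoothTransition.contDiff.comp (contDiff_id.sub contDiff_const)

theorem smoothStep_of_le {t : ℝ} (ht : t ≤ 1) : smoothStep t = 0 :=
  Real.smoothTransition.zero_of_nonpos (by linarith)

theorem smoothStep_of_ge {t : ℝ} (ht : 2 ≤ t) : smoothStep t = 1 :=
  Real.smoothTransition.one_of_one_le (by linarith)

theorem deriv_smoothStep_of_gt {t : ℝ} (ht : 2 < t) : deriv smoothStep t = 0 := by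
  have : smoothStep =ᶠ[𝓝 t] fun _ => 1 := by
    filter_upwards [lt_mem_nhds ht] with s hs using smoothStep_of_ge hs.le
  rw [this.deriv_eq, deriv_const]

theorem deriv_deriv_smoothStep_of_gt {t : ℝ} (ht : 2 < t) : deriv (deriv smoothStep) t = 0 := by
  have : deriv smoothStep =ᶠ[𝓝 t] fun _ => 0 := by
    filter_upwards [lt_mem_nhds ht] with s hs using deriv_smoothStep_of_gt hs
  rw [this.deriv_eq, deriv_const]

/-- As a function of `t = |x|²`, the double divergence of the reflection field
`smoothStep t * (2 x ⊗ x / t - I)`. -/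
noncomputable def stepProfile (t : ℝ) : ℝ :=
  8 * deriv smoothStep t + 4 * t * deriv (deriv smoothStep) t

theorem contDiff_stepProfile : ContDiff ℝ ∞ stepProfile := by
  have h1 := contDiff_deriv_infty contDiff_smoothStep
  have h2 := contDiff_deriv_infty h1
  exact (contDiff_const.mul h1).add ((contDiff_const.mul contDiff_id).mul h2)

theorem stepProfile_of_gt {t : ℝ} (ht : 2 < t) : stepProfile t = 0 := by
  rw [stepProfile, deriv_smoothStep_of_gt ht, deriv_deriv_smoothStep_of_gt ht]
  ring

theorem integral_deriv_stepProfile :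
    ∫ t in Set.Ioc (0 : ℝ) 3, -deriv stepProfile t * t = 4 := by
  have h1 := contDiff_deriv_infty contDiff_smoothStep
  have hd : ∀ t ∈ Set.uIcc (0 : ℝ) 3, HasDerivAt
      (fun t => -(stepProfile t * t) + (4 * smoothStep t + 4 * (t * deriv smoothStep t)))
      (-deriv stepProfile t * t) t := by
    intro t _
    have d1 := (contDiff_stepProfile.differentiable (by simp) t).hasDerivAt
    have d2 := (contDiff_smoothStep.differentiable (by simp) t).hasDerivAt
    have d3 := (h1.differentiable (by simp) t).hasDerivAt
    refine ((d1.mul (hasDerivAt_id t)).neg.add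
      ((d2.const_mul 4).add (((hasDerivAt_id t).mul d3).const_mul 4))).congr_deriv ?_
    simp only [id_eq, stepProfile]
    ring
  have hi : IntervalIntegrable (fun t => -deriv stepProfile t * t) volume 0 3 := by
    have := (contDiff_deriv_infty contDiff_stepProfile).continuous
    exact (this.neg.mul continuous_id).intervalIntegrable _ _
  rw [← intervalIntegral.integral_of_le (by norm_num),
    intervalIntegral.integral_eq_sub_of_hasDerivAt hd hi, stepProfile_of_gt (by norm_num),
    deriv_smoothStep_of_gt (by norm_num), smoothStep_of_ge (by norm_num),
    smoothStep_of_le (by norm_num)]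
  norm_num

/-- The coefficient of a reflection field of norm `c`, smoothed out in `|x|² < 2 δ` and cut off
at `|x|² = R`. -/
noncomputable def stepCoeff (c δ R t : ℝ) : ℝ :=
  c * (smoothStep (δ⁻¹ * t) * Real.smoothTransition (R - t)) / t

variable {c δ R : ℝ}

theorem mul_stepCoeff (t : ℝ) :
    t * stepCoeff c δ R t = c * (smoothStep (δ⁻¹ * t) * Real.smoothTransition (R - t)) := by
  rcases eq_or_ne t 0 with rfl | ht
  · simp [smoothStep_of_le]
  · rw [stepCoeff, mul_div_cancel₀ _ ht]

theorem stepCoeff_of_ge {t : ℝ} (ht : R ≤ t) : stepCoeff c δ R t = 0 := by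
  rw [stepCoeff, Real.smoothTransition.zero_of_nonpos (by linarith)]
  simp

theorem contDiff_stepCoeff (hδ : 0 < δ) : ContDiff ℝ ∞ (stepCoeff c δ R) := by
  rw [contDiff_iff_contDiffAt]
  intro t
  rcases eq_or_ne t 0 with rfl | ht
  · have : stepCoeff c δ R =ᶠ[𝓝 0] fun _ => 0 := by
      filter_upwards [gt_mem_nhds hδ] with s hs
      rw [stepCoeff, smoothStep_of_le ((inv_mul_le_iff₀ hδ).2 (by linarith))]
      simp
    exact contDiffAt_const.congr_of_eventuallyEq this
  · have h1 : ContDiff ℝ ∞ fun t : ℝ => smoothStep (δ⁻¹ * t) :=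
      contDiff_smoothStep.comp (contDiff_const.mul contDiff_id)
    have h2 : ContDiff ℝ ∞ fun t : ℝ => Real.smoothTransition (R - t) :=
      Real.smoothTransition.contDiff.comp (contDiff_const.sub contDiff_id)
    exact (contDiff_const.mul (h1.mul h2)).contDiffAt.div contDiffAt_id ht

theorem doubleDiv_reflectionField_stepCoeff (hδ : 0 < δ) {x : EuclideanSpace ℝ (Fin 2)}
    (hx : ‖x‖ ^ 2 < R - 1) :
    doubleDiv (reflectionField (stepCoeff c δ R)) x =
      c * (δ⁻¹ * stepProfile (δ⁻¹ * ‖x‖ ^ 2)) := by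
  have e : (fun t => t * stepCoeff c δ R t) =ᶠ[𝓝 (‖x‖ ^ 2)] fun t => c * smoothStep (δ⁻¹ * t) := by
    filter_upwards [gt_mem_nhds hx] with t ht
    rw [mul_stepCoeff, Real.smoothTransition.one_of_one_le (by linarith), mul_one]
  have d1 : deriv (fun t => c * smoothStep (δ⁻¹ * t)) =
      fun t => c * δ⁻¹ * deriv smoothStep (δ⁻¹ * t) := by
    ext t
    rw [deriv_const_mul_field, deriv_comp_mul_left, smul_eq_mul, mul_assoc]
  rw [doubleDiv_reflectionField (contDiff_stepCoeff hδ), e.deriv_eq, e.deriv.deriv_eq, d1,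
    deriv_const_mul_field, deriv_comp_mul_left, smul_eq_mul, stepProfile]
  ring

theorem schattenNorm_reflectionField {q : ℝ≥0∞} (hq : 1 ≤ q) (b : ℝ → ℝ)
    (x : EuclideanSpace ℝ (Fin 2)) :
    schattenNorm q (reflectionField b x) = 2 ^ (q⁻¹).toReal * |‖x‖ ^ 2 * b (‖x‖ ^ 2)| := by
  apply schattenNorm_of_singularValues_eq _ hq (abs_nonneg _)
  · rw [sq_abs]
    simp [reflectionField, norm_sq_fin_two x]
    ring
  · rw [sq_abs, ← abs_of_nonneg (sq_nonneg (‖x‖ ^ 2 * b (‖x‖ ^ 2))), ← abs_neg]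
    congr 1
    simp [reflectionField, Matrix.det_fin_two, norm_sq_fin_two x]
    ring

theorem isTestField_reflectionField {q : ℝ≥0∞} (hq : 1 ≤ q) (hδ : 0 < δ) :
    IsTestField q Set.univ
      (reflectionField (stepCoeff ((2 : ℝ) ^ (-(q⁻¹).toReal)) δ R)) := by
  have hb := contDiff_comp_norm_sq (d := 2) (contDiff_stepCoeff (c := 2 ^ (-(q⁻¹).toReal))
    (R := R) hδ)
  have hbc : HasCompactSupport fun x : EuclideanSpace ℝ (Fin 2) =>
      stepCoeff ((2 : ℝ) ^ (-(q⁻¹).toReal)) δ R (‖x‖ ^ 2) := by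
    refine HasCompactSupport.intro (isCompact_closedBall 0 √R) fun x hx => ?_
    apply stepCoeff_of_ge
    rw [mem_closedBall_zero_iff, not_le] at hx
    exact ((Real.sqrt_lt' ((Real.sqrt_nonneg R).trans_lt hx)).1 hx).le
  have hc (j : Fin 2) : ContDiff ℝ ∞ fun y : EuclideanSpace ℝ (Fin 2) => y j := contDiff_coord j
  refine ⟨fun i j => ?_, fun i j => ?_, fun _ _ => Set.subset_univ _, fun x => ?_⟩
  · fin_cases i <;> fin_cases j
    · exact hb.mul (((hc 0).mul (hc 0)).sub ((hc 1).mul (hc 1)))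
    · exact hb.mul (contDiff_const.mul ((hc 0).mul (hc 1)))
    · exact hb.mul (contDiff_const.mul ((hc 0).mul (hc 1)))
    · exact hb.mul (((hc 1).mul (hc 1)).sub ((hc 0).mul (hc 0)))
  · fin_cases i <;> fin_cases j <;> exact hbc.mul_right
  · rw [schattenNorm_reflectionField hq, mul_stepCoeff]
    have h1 : 0 ≤ smoothStep (δ⁻¹ * ‖x‖ ^ 2) := Real.smoothTransition.nonneg _
    have h2 : smoothStep (δ⁻¹ * ‖x‖ ^ 2) ≤ 1 := Real.smoothTransition.le_one _
    have h3 := Real.smoothTransition.nonneg (R - ‖x‖ ^ 2)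
    have h4 := Real.smoothTransition.le_one (R - ‖x‖ ^ 2)
    rw [abs_of_nonneg (mul_nonneg (by positivity) (mul_nonneg h1 h3)), ← mul_assoc,
      ← Real.rpow_add two_pos, add_neg_cancel, Real.rpow_zero, one_mul]
    exact mul_le_one₀ h2 h3 h4

theorem IsBump.integrable {f : EuclideanSpace ℝ (Fin 2) → ℝ} (hf : IsBump f) : Integrable f := by
  obtain ⟨K, hK, hfK⟩ := hf.compactSupport
  exact (hf.locallyIntegrable.integrableOn_isCompact hK).integrable_of_ae_notMem_eq_zero hfK

theorem one_le_conjExponent (p : ℝ≥0∞) : 1 ≤ ENNReal.conjExponent p := le_self_add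

theorem toReal_inv_conjExponent {p : ℝ≥0∞} (hp : 1 ≤ p) :
    ((ENNReal.conjExponent p)⁻¹).toReal = 1 - (p⁻¹).toReal := by
  have h := ENNReal.HolderConjugate.conjExponent hp
  rw [← h.one_sub_inv, ENNReal.toReal_sub_of_le (ENNReal.inv_le_one.2 hp) ENNReal.one_ne_top,
    ENNReal.toReal_one]

theorem IsBump.le_hessianSchattenVariation {f : EuclideanSpace ℝ (Fin 2) → ℝ} (hf : IsBump f)
    {p : ℝ≥0∞} (hp : 1 ≤ p) :
    ENNReal.ofReal ((2 : ℝ) ^ (1 + (p⁻¹).toReal) * Real.pi) ≤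
      hessianSchattenVariation p f Set.univ := by
  obtain ⟨K, hK, hfK⟩ := hf.compactSupport
  obtain ⟨ρ, hρ⟩ := hK.isBounded.exists_norm_le
  set q := ENNReal.conjExponent p with hq
  have hq1 : 1 ≤ q := one_le_conjExponent p
  set c : ℝ := (2 : ℝ) ^ (-(q⁻¹).toReal) with hc
  have hlim := (tendsto_integral_mul_comp_norm_sq hf.integrable hf.value_zero
    contDiff_stepProfile (L := 3) fun t ht => stepProfile_of_gt (by linarith)).const_mul c
  rw [integral_deriv_stepProfile] at hlim
  have hval : c * (1 * Real.pi * 4) = (2 : ℝ) ^ (1 + (p⁻¹).toReal) * Real.pi := by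
    have : (1 : ℝ) + (p⁻¹).toReal = -(q⁻¹).toReal + 2 := by
      rw [toReal_inv_conjExponent hp]; ring
    rw [this, Real.rpow_add two_pos, hc]
    norm_num
    ring
  rw [hval] at hlim
  refine le_of_tendsto (ENNReal.tendsto_ofReal hlim) ?_
  filter_upwards [self_mem_nhdsWithin] with ε hε
  have hε2 : 0 < ε ^ 2 := pow_pos hε 2
  have hF : IsTestField q Set.univ (reflectionField (stepCoeff c (ε ^ 2) (ρ ^ 2 + 2))) :=
    isTestField_reflectionField hq1 hε2
  have e : c * ((ε ^ 2)⁻¹ * ∫ x, f x * stepProfile ((ε ^ 2)⁻¹ * ‖x‖ ^ 2)) =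
      ∫ x in Set.univ, f x * doubleDiv (reflectionField (stepCoeff c (ε ^ 2) (ρ ^ 2 + 2))) x := by
    rw [setIntegral_univ, ← integral_const_mul, ← integral_const_mul]
    refine integral_congr_ae ?_
    filter_upwards [hfK] with x hx
    by_cases hxK : x ∈ K
    · have : ‖x‖ ^ 2 ≤ ρ ^ 2 := by gcongr; exact hρ x hxK
      rw [doubleDiv_reflectionField_stepCoeff hε2 (by linarith)]
      ring
    · simp [hx hxK]
  rw [e]
  exact le_iSup₂_of_le _ hF le_rfl

end LowerBound
section RadialBound

theorem integral_comp_norm_sq (B : ℝ → ℝ) :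
    ∫ x : EuclideanSpace ℝ (Fin 2), B (‖x‖ ^ 2) = Real.pi * ∫ t in Set.Ioi 0, B t := by
  have h1 := integral_fun_norm_addHaar (volume : Measure (EuclideanSpace ℝ (Fin 2)))
    (fun r => B (r ^ 2))
  have h2 := integral_comp_rpow_Ioi_of_pos (g := B) (two_pos : (0 : ℝ) < 2)
  have h3 : volume.real (Metric.ball (0 : EuclideanSpace ℝ (Fin 2)) 1) = Real.pi := by
    rw [Measure.real, EuclideanSpace.volume_ball_fin_two]
    simp [Real.pi_pos.le]
  rw [h1, h3, ← h2]
  simp only [finrank_euclideanSpace, Fintype.card_fin, smul_eq_mul, nsmul_eq_mul]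
  norm_num
  have h4 : ∀ r : ℝ, 2 * r * B (r ^ 2) = 2 * (r * B (r ^ 2)) := fun r => mul_assoc _ _ _
  simp only [h4, integral_const_mul]
  ring

theorem integral_mul_doubleDiv_le {f : EuclideanSpace ℝ (Fin 2) → ℝ} (hf : ContDiff ℝ ∞ f)
    {q : ℝ≥0∞} {B : ℝ → ℝ} (hB : Continuous B) (hB0 : ∀ t, 1 ≤ t → B t = 0)
    (hbound : ∀ M : Matrix (Fin 2) (Fin 2) ℝ, schattenNorm q M ≤ 1 → ∀ x,
      ∑ i, ∑ j, partialDeriv j (partialDeriv i f) x * M i j ≤ B (‖x‖ ^ 2))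
    {A : Set (EuclideanSpace ℝ (Fin 2))} {F : EuclideanSpace ℝ (Fin 2) → Matrix (Fin 2) (Fin 2) ℝ}
    (hF : IsTestField q A F) :
    ∫ x, f x * doubleDiv F x ≤ Real.pi * ∫ t in (0 : ℝ)..1, B t := by
  have h1 : ∫ t in Set.Ioi 0, B t = ∫ t in (0 : ℝ)..1, B t := by
    rw [intervalIntegral.integral_of_le zero_le_one]
    refine (setIntegral_eq_of_subset_of_forall_sdiff_eq_zero measurableSet_Ioi
      Set.Ioc_subset_Ioi_self fun t ht => hB0 t ?_)
    by_contra! h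
    exact ht.2 ⟨ht.1, h.le⟩
  rw [integral_mul_doubleDiv hf hF, ← h1, ← integral_comp_norm_sq]
  refine integral_mono ?_ ?_ fun x => hbound (F x) (hF.norm_le x) x
  · refine integrable_finsetSum _ fun i _ => integrable_finsetSum _ fun j _ => ?_
    exact ((contDiff_partialDeriv (contDiff_partialDeriv hf i) j).continuous.mul
      (hF.smooth i j).continuous).integrable_of_hasCompactSupport (hF.compactSupport i j).mul_left
  · refine Continuous.integrable_of_hasCompactSupport (by fun_prop)
      (HasCompactSupport.intro (isCompact_closedBall 0 1) fun x hx => hB0 _ ?_)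
    rw [mem_closedBall_zero_iff, not_le] at hx
    nlinarith

/-- The radial function whose value is `∫ s in t..1, w s` where `|x|² = t`. -/
noncomputable def radialPrimitive (w : ℝ → ℝ) (x : EuclideanSpace ℝ (Fin 2)) : ℝ :=
  ∫ s in ‖x‖ ^ 2..1, w s

variable {w : ℝ → ℝ}

theorem deriv_primitive (hw : ContDiff ℝ ∞ w) : deriv (fun t => ∫ s in t..1, w s) = -w := by
  ext t
  exact (intervalIntegral.integral_hasDerivAt_left (hw.continuous.intervalIntegrable _ _)
    (hw.continuous.stronglyMeasurableAtFilter _ _) hw.continuous.continuousAt).deriv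

theorem contDiff_primitive (hw : ContDiff ℝ ∞ w) : ContDiff ℝ ∞ fun t => ∫ s in t..1, w s := by
  rw [contDiff_infty_iff_deriv, deriv_primitive hw]
  exact ⟨fun t => (intervalIntegral.integral_hasDerivAt_left
    (hw.continuous.intervalIntegrable _ _) (hw.continuous.stronglyMeasurableAtFilter _ _)
    hw.continuous.continuousAt).differentiableAt, hw.neg⟩

theorem contDiff_radialPrimitive (hw : ContDiff ℝ ∞ w) : ContDiff ℝ ∞ (radialPrimitive w) :=
  contDiff_comp_norm_sq (contDiff_primitive hw)

theorem sum_hessian_radialPrimitive (hw : ContDiff ℝ ∞ w) (M : Matrix (Fin 2) (Fin 2) ℝ)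
    (x : EuclideanSpace ℝ (Fin 2)) :
    ∑ i, ∑ j, partialDeriv j (partialDeriv i (radialPrimitive w)) x * M i j =
      -(4 * deriv w (‖x‖ ^ 2) * (M 0 0 * x 0 ^ 2 + (M 0 1 + M 1 0) * (x 0 * x 1) +
        M 1 1 * x 1 ^ 2) + 2 * w (‖x‖ ^ 2) * (M 0 0 + M 1 1)) := by
  have h (i j : Fin 2) := partialDeriv_partialDeriv_comp_norm_sq (contDiff_primitive hw) i j x
  have e : deriv (-w) = fun t => -deriv w t := by
    ext t
    exact deriv.neg
  simp only [deriv_primitive hw, e, Pi.neg_apply] at h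
  simp only [Fin.sum_univ_two]
  unfold radialPrimitive
  rw [h, h, h, h]
  simp
  ring

theorem sum_hessian_radialPrimitive_le (hw : ContDiff ℝ ∞ w) {a : ℝ} (ha : 0 < a)
    (hwa : ∀ t, t ≤ a → w t = 0) (hw0 : ∀ t, 0 ≤ w t) {M : Matrix (Fin 2) (Fin 2) ℝ} {q : ℝ≥0∞}
    (hq : 1 ≤ q) (hM : schattenNorm q M ≤ 1) (x : EuclideanSpace ℝ (Fin 2)) :
    ∑ i, ∑ j, partialDeriv j (partialDeriv i (radialPrimitive w)) x * M i j ≤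
      |4 * (‖x‖ ^ 2 * deriv w (‖x‖ ^ 2)) + 2 * w (‖x‖ ^ 2)| + 2 * w (‖x‖ ^ 2) := by
  rw [sum_hessian_radialPrimitive hw]
  rcases eq_or_ne x 0 with rfl | hx
  · simp [hwa 0 ha.le]
  have h0 := (singularValues_zero_le_schattenNorm M hq).trans hM
  have ht : 0 < ‖x‖ ^ 2 := by positivity
  have h1 := (abs_quadratic_le M (x 0) (x 1)).trans
    (mul_le_mul_of_nonneg_right h0 (by positivity))
  have h2 := (abs_quadratic_le M (-x 1) (x 0)).trans
    (mul_le_mul_of_nonneg_right h0 (by positivity))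
  rw [one_mul, ← norm_sq_fin_two] at h1
  rw [one_mul, neg_sq, add_comm (x 1 ^ 2), ← norm_sq_fin_two] at h2
  set Q := M 0 0 * x 0 ^ 2 + (M 0 1 + M 1 0) * (x 0 * x 1) + M 1 1 * x 1 ^ 2
  set Q' := M 0 0 * x 1 ^ 2 + (M 0 1 + M 1 0) * (-x 1 * x 0) + M 1 1 * x 0 ^ 2
  have htr : ‖x‖ ^ 2 * (M 0 0 + M 1 1) = Q + Q' := by
    rw [norm_sq_fin_two]
    simp only [Q, Q']
    ring
  set t := ‖x‖ ^ 2
  have hQ (u : ℝ) : u * -Q ≤ |u| * t := by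
    refine (le_abs_self _).trans ?_
    rw [abs_mul, abs_neg]
    gcongr
  have hwt : 0 ≤ 2 * w t := mul_nonneg two_pos.le (hw0 t)
  refine le_of_mul_le_mul_left ?_ ht
  calc _ = (4 * (t * deriv w t) + 2 * w t) * -Q + 2 * w t * -Q' := by
        linear_combination (-2 * w t) * htr
    _ ≤ |4 * (t * deriv w t) + 2 * w t| * t + 2 * w t * t :=
        add_le_add (hQ _) (mul_le_mul_of_nonneg_left ((neg_le_abs _).trans h2) hwt)
    _ = _ := by ring

theorem sum_hessian_radialPrimitive_le' (hw : ContDiff ℝ ∞ w) {a : ℝ} (ha : 0 < a)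
    (hwa : ∀ t, t ≤ a → w t = 0) (hw0 : ∀ t, 0 ≤ w t) {M : Matrix (Fin 2) (Fin 2) ℝ} {q : ℝ≥0∞}
    (hq : 1 ≤ q) (hM : schattenNorm q M ≤ 1) (x : EuclideanSpace ℝ (Fin 2)) :
    ∑ i, ∑ j, partialDeriv j (partialDeriv i (radialPrimitive w)) x * M i j ≤
      4 * |‖x‖ ^ 2 * deriv w (‖x‖ ^ 2) + w (‖x‖ ^ 2)| +
        2 ^ (1 - (q⁻¹).toReal) * (2 * w (‖x‖ ^ 2)) := by
  rw [sum_hessian_radialPrimitive hw]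
  rcases eq_or_ne x 0 with rfl | hx
  · simp [hwa 0 ha.le]
  have h0 := (singularValues_zero_le_schattenNorm M hq).trans hM
  have h0' := (add_singularValues_le_schattenNorm M hq).trans
    (mul_le_mul_of_nonneg_left hM (by positivity))
  rw [mul_one] at h0'
  set C : ℝ := 2 ^ (1 - (q⁻¹).toReal)
  have ht : 0 < ‖x‖ ^ 2 := by positivity
  have h1 := (abs_quadratic_le M (x 0) (x 1)).trans
    (mul_le_mul_of_nonneg_right h0 (by positivity))
  have h2 := (abs_reflection_le M (x 0) (x 1)).trans
    (mul_le_mul_of_nonneg_right h0' (by positivity))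
  rw [one_mul, ← norm_sq_fin_two] at h1
  rw [← norm_sq_fin_two] at h2
  set Q := M 0 0 * x 0 ^ 2 + (M 0 1 + M 1 0) * (x 0 * x 1) + M 1 1 * x 1 ^ 2
  set R := (M 0 0 - M 1 1) * (x 1 ^ 2 - x 0 ^ 2) - 2 * (M 0 1 + M 1 0) * (x 0 * x 1)
  have htr : ‖x‖ ^ 2 * (M 0 0 + M 1 1) = 2 * Q + R := by
    rw [norm_sq_fin_two]
    simp only [Q, R]
    ring
  set t := ‖x‖ ^ 2
  have hQ (u : ℝ) : u * -Q ≤ |u| * t := by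
    refine (le_abs_self _).trans ?_
    rw [abs_mul, abs_neg]
    gcongr
  have hwt : 0 ≤ 2 * w t := mul_nonneg two_pos.le (hw0 t)
  refine le_of_mul_le_mul_left ?_ ht
  calc _ = 4 * ((t * deriv w t + w t) * -Q) + 2 * w t * -R := by
        linear_combination (-2 * w t) * htr
    _ ≤ 4 * (|t * deriv w t + w t| * t) + 2 * w t * (C * t) :=
        add_le_add (mul_le_mul_of_nonneg_left (hQ _) (by norm_num))
          (mul_le_mul_of_nonneg_left ((neg_le_abs _).trans h2) hwt)
    _ = _ := by ring

theorem radialPrimitive_of_one_le (hw1 : ∀ t, 1 ≤ t → w t = 0)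
    {x : EuclideanSpace ℝ (Fin 2)} (hx : 1 ≤ ‖x‖) : radialPrimitive w x = 0 := by
  have hx2 : 1 ≤ ‖x‖ ^ 2 := by nlinarith
  rw [radialPrimitive, intervalIntegral.integral_symm, neg_eq_zero]
  refine intervalIntegral.integral_zero_ae (Eventually.of_forall fun t ht => hw1 t ?_)
  rw [Set.uIoc_of_le hx2] at ht
  exact ht.1.le

theorem isBump_of_continuous {f : EuclideanSpace ℝ (Fin 2) → ℝ} (hf : Continuous f)
    (hf1 : ∀ x, 1 ≤ ‖x‖ → f x = 0) (hf0 : f 0 = 1) : IsBump f := by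
  refine ⟨hf.locallyIntegrable, ⟨Metric.closedBall 0 1, isCompact_closedBall 0 1,
    Eventually.of_forall fun x hx => hf1 x ?_⟩, (hasPointValue_iff hf .rfl 0 1).2 hf0⟩
  rw [mem_closedBall_zero_iff, not_le] at hx
  exact hx.le

theorem isBump_radialPrimitive (hw : ContDiff ℝ ∞ w) (hw1 : ∀ t, 1 ≤ t → w t = 0)
    (hint : ∫ t in (0 : ℝ)..1, w t = 1) : IsBump (radialPrimitive w) :=
  isBump_of_continuous (contDiff_radialPrimitive hw).continuous
    (fun _ hx => radialPrimitive_of_one_le hw1 hx) (by simpa [radialPrimitive] using hint)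

theorem isBump_cutCone : IsBump cutCone :=
  isBump_of_continuous (by unfold cutCone; fun_prop)
    (fun x hx => max_eq_right (by linarith)) (by simp [cutCone])

end RadialBound
theorem deriv_eq_zero_of_nonneg {w : ℝ → ℝ} (hw : ∀ t, 0 ≤ w t) {t : ℝ} (ht : w t = 0) :
    deriv w t = 0 :=
  IsLocalMin.deriv_eq_zero (Eventually.of_forall fun s => ht.trans_le (hw s))

section Cutoff

/-- A smooth cutoff on `(0, 1)`, equal to `1` on `[2 / n, 1 - 1 / n]`. -/
noncomputable def cutoff (n t : ℝ) : ℝ :=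
  Real.smoothTransition (n * t - 1) * Real.smoothTransition (n * (1 - t))

variable {n : ℝ}

theorem contDiff_cutoff_left (n : ℝ) : ContDiff ℝ ∞ fun t => Real.smoothTransition (n * t - 1) :=
  Real.smoothTransition.contDiff.comp ((contDiff_const.mul contDiff_id).sub contDiff_const)

theorem contDiff_cutoff_right (n : ℝ) :
    ContDiff ℝ ∞ fun t => Real.smoothTransition (n * (1 - t)) :=
  Real.smoothTransition.contDiff.comp (contDiff_const.mul (contDiff_const.sub contDiff_id))

theorem contDiff_cutoff (n : ℝ) : ContDiff ℝ ∞ (cutoff n) :=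
  (contDiff_cutoff_left n).mul (contDiff_cutoff_right n)

theorem cutoff_nonneg (n t : ℝ) : 0 ≤ cutoff n t :=
  mul_nonneg (Real.smoothTransition.nonneg _) (Real.smoothTransition.nonneg _)

theorem cutoff_le_one (n t : ℝ) : cutoff n t ≤ 1 :=
  mul_le_one₀ (Real.smoothTransition.le_one _) (Real.smoothTransition.nonneg _)
    (Real.smoothTransition.le_one _)

theorem cutoff_of_le (hn : 0 < n) {t : ℝ} (ht : t ≤ n⁻¹) : cutoff n t = 0 := by
  have : n * t ≤ 1 := by
    calc n * t ≤ n * n⁻¹ := by gcongr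
      _ = 1 := mul_inv_cancel₀ hn.ne'
  rw [cutoff, Real.smoothTransition.zero_of_nonpos (by linarith), zero_mul]

theorem cutoff_of_one_le (hn : 0 < n) {t : ℝ} (ht : 1 ≤ t) : cutoff n t = 0 := by
  rw [cutoff, Real.smoothTransition.zero_of_nonpos (x := n * (1 - t))
    (mul_nonpos_of_nonneg_of_nonpos hn.le (by linarith)), mul_zero]

theorem cutoff_eq_one {t : ℝ} (h1 : 2 ≤ n * t) (h2 : 1 ≤ n * (1 - t)) : cutoff n t = 1 := by
  rw [cutoff, Real.smoothTransition.one_of_one_le (by linarith),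
    Real.smoothTransition.one_of_one_le h2, mul_one]

theorem deriv_cutoff_left_nonneg (hn : 0 < n) (t : ℝ) :
    0 ≤ deriv (fun t => Real.smoothTransition (n * t - 1)) t := by
  apply Monotone.deriv_nonneg
  exact fun a b hab => Real.smoothTransition.monotone (by gcongr)

theorem deriv_cutoff_right_nonpos (hn : 0 < n) (t : ℝ) :
    deriv (fun t => Real.smoothTransition (n * (1 - t))) t ≤ 0 := by
  apply Antitone.deriv_nonpos
  exact fun a b hab => Real.smoothTransition.monotone (by gcongr)

theorem deriv_cutoff_left_of_gt {t : ℝ} (hn : 0 < n) (ht : 2 / n < t) :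
    deriv (fun t => Real.smoothTransition (n * t - 1)) t = 0 := by
  have : (fun t => Real.smoothTransition (n * t - 1)) =ᶠ[𝓝 t] fun _ => 1 := by
    filter_upwards [lt_mem_nhds ht] with s hs
    have := (div_lt_iff₀' hn).1 hs
    exact Real.smoothTransition.one_of_one_le (by linarith)
  rw [this.deriv_eq, deriv_const]

theorem abs_deriv_cutoff_le (hn : 0 < n) (t : ℝ) :
    |deriv (cutoff n) t| ≤ deriv (fun t => Real.smoothTransition (n * t - 1)) t -
      deriv (fun t => Real.smoothTransition (n * (1 - t))) t := by
  have h1 := deriv_cutoff_left_nonneg hn t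
  have h2 := deriv_cutoff_right_nonpos hn t
  have e := (((contDiff_cutoff_left n).differentiable (by simp) t).hasDerivAt.mul
    ((contDiff_cutoff_right n).differentiable (by simp) t).hasDerivAt).deriv
  have e' : deriv (cutoff n) t = _ := e
  rw [e']
  have h3 := Real.smoothTransition.nonneg (n * t - 1)
  have h4 := Real.smoothTransition.le_one (n * t - 1)
  have h5 := Real.smoothTransition.nonneg (n * (1 - t))
  have h6 := Real.smoothTransition.le_one (n * (1 - t))
  rw [abs_le]
  constructor <;> nlinarith

theorem intervalIntegrable_deriv {g : ℝ → ℝ} (hg : ContDiff ℝ ∞ g) (a b : ℝ) :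
    IntervalIntegrable (deriv g) volume a b :=
  (contDiff_deriv_infty hg).continuous.intervalIntegrable _ _

theorem integral_deriv_cutoff_left (hn : 2 ≤ n) :
    ∫ t in (0 : ℝ)..1, deriv (fun t => Real.smoothTransition (n * t - 1)) t = 1 := by
  rw [intervalIntegral.integral_deriv_eq_sub
    (fun t _ => (contDiff_cutoff_left n).differentiable (by simp) t)
    (intervalIntegrable_deriv (contDiff_cutoff_left n) _ _),
    Real.smoothTransition.one_of_one_le (by linarith),
    Real.smoothTransition.zero_of_nonpos (by linarith), sub_zero]

theorem integral_deriv_cutoff_right (hn : 2 ≤ n) :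
    ∫ t in (0 : ℝ)..1, deriv (fun t => Real.smoothTransition (n * (1 - t))) t = -1 := by
  rw [intervalIntegral.integral_deriv_eq_sub
    (fun t _ => (contDiff_cutoff_right n).differentiable (by simp) t)
    (intervalIntegrable_deriv (contDiff_cutoff_right n) _ _),
    Real.smoothTransition.zero_of_nonpos (by linarith),
    Real.smoothTransition.one_of_one_le (by linarith), zero_sub]

theorem integral_abs_deriv_cutoff_le (hn : 2 ≤ n) :
    ∫ t in (0 : ℝ)..1, |deriv (cutoff n) t| ≤ 2 := by
  have hl := intervalIntegrable_deriv (contDiff_cutoff_left n) 0 1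
  have hr := intervalIntegrable_deriv (contDiff_cutoff_right n) 0 1
  calc _ ≤ ∫ t in (0 : ℝ)..1, (deriv (fun t => Real.smoothTransition (n * t - 1)) t -
      deriv (fun t => Real.smoothTransition (n * (1 - t))) t) :=
        intervalIntegral.integral_mono_on zero_le_one
          (intervalIntegrable_deriv (contDiff_cutoff n) 0 1).abs (hl.sub hr)
          fun t _ => abs_deriv_cutoff_le (by linarith) t
    _ = 2 := by
        rw [intervalIntegral.integral_sub hl hr, integral_deriv_cutoff_left hn,
          integral_deriv_cutoff_right hn]
        norm_num

theorem contDiff_cutoff_mul (hn : 0 < n) {g : ℝ → ℝ} (hg : ContDiffOn ℝ ∞ g (Set.Ioi 0)) :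
    ContDiff ℝ ∞ fun t => cutoff n t * g t := by
  rw [contDiff_iff_contDiffAt]
  intro t
  rcases lt_or_ge 0 t with ht | ht
  · exact (contDiff_cutoff n).contDiffAt.mul (hg.contDiffAt (Ioi_mem_nhds ht))
  · have : (fun t => cutoff n t * g t) =ᶠ[𝓝 t] fun _ => 0 := by
      filter_upwards [gt_mem_nhds (ht.trans_lt (inv_pos.2 hn))] with s hs
      rw [cutoff_of_le hn hs.le, zero_mul]
    exact contDiffAt_const.congr_of_eventuallyEq this

theorem contDiff_cutoff_mul_inv (hn : 0 < n) : ContDiff ℝ ∞ fun t => cutoff n t * t⁻¹ :=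
  contDiff_cutoff_mul hn (contDiffOn_id.inv fun _ ht => ht.ne')

theorem contDiff_cutoff_mul_inv_sqrt (hn : 0 < n) :
    ContDiff ℝ ∞ fun t => cutoff n t * (2 * √t)⁻¹ := by
  refine contDiff_cutoff_mul hn (ContDiffOn.inv ?_ fun t ht => ?_)
  · exact contDiffOn_const.mul (contDiffOn_id.sqrt fun _ ht => ht.ne')
  · have := Real.sqrt_pos.2 ht
    positivity

end Cutoff

section Logarithm

variable {n : ℝ}

/-- The normalization of the truncated logarithm. -/
noncomputable def logMass (n : ℝ) : ℝ := ∫ t in (0 : ℝ)..1, cutoff n t * t⁻¹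

theorem log_le_logMass (hn : 4 ≤ n) : Real.log (n / 4) ≤ logMass n := by
  have hn0 : 0 < n := by linarith
  have h2n : 0 < 2 / n := by positivity
  have h2n' : 2 / n ≤ 1 / 2 := by
    rw [div_le_div_iff₀ hn0 two_pos]; linarith
  have e : Real.log (n / 4) = ∫ t in (2 / n)..(1 / 2), cutoff n t * t⁻¹ := by
    have h := integral_inv_of_pos h2n (one_half_pos (α := ℝ))
    rw [show (1 : ℝ) / 2 / (2 / n) = n / 4 by field_simp; norm_num] at h
    rw [← h]
    refine intervalIntegral.integral_congr fun t ht => ?_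
    rw [Set.uIcc_of_le h2n'] at ht
    have h1 := (div_le_iff₀' hn0).1 ht.1
    have h2 : n * (1 / 2) ≤ n * (1 - t) := by gcongr; linarith [ht.2]
    rw [cutoff_eq_one h1 (by linarith), one_mul]
  rw [e, logMass]
  refine intervalIntegral.integral_mono_interval h2n.le h2n' (by norm_num) ?_
    ((contDiff_cutoff_mul_inv hn0).continuous.intervalIntegrable _ _)
  refine (ae_restrict_iff' measurableSet_Ioc).2 (Eventually.of_forall fun t ht => ?_)
  exact mul_nonneg (cutoff_nonneg n t) (inv_nonneg.2 ht.1.le)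

/-- Minus the derivative with respect to `t = |x|²` of the truncated logarithm. -/
noncomputable def logWeight (n t : ℝ) : ℝ := (logMass n)⁻¹ * (cutoff n t * t⁻¹)

theorem contDiff_logWeight (hn : 0 < n) : ContDiff ℝ ∞ (logWeight n) :=
  contDiff_const.mul (contDiff_cutoff_mul_inv hn)

theorem logWeight_of_one_le (hn : 0 < n) {t : ℝ} (ht : 1 ≤ t) : logWeight n t = 0 := by
  rw [logWeight, cutoff_of_one_le hn ht]; simp

theorem logWeight_of_le (hn : 0 < n) {t : ℝ} (ht : t ≤ n⁻¹) : logWeight n t = 0 := by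
  rw [logWeight, cutoff_of_le hn ht]; simp

theorem logWeight_nonneg (hn : 0 < n) (hI : 0 < logMass n) (t : ℝ) : 0 ≤ logWeight n t := by
  rcases le_total t n⁻¹ with h | h
  · exact (logWeight_of_le hn h).ge
  · have ht : 0 ≤ t := (inv_nonneg.2 hn.le).trans h
    have := cutoff_nonneg n t
    unfold logWeight
    positivity

theorem integral_logWeight (hI : 0 < logMass n) : ∫ t in (0 : ℝ)..1, logWeight n t = 1 := by
  unfold logWeight
  rw [intervalIntegral.integral_const_mul, ← logMass, inv_mul_cancel₀ hI.ne']

theorem deriv_logWeight (hn : 0 < n) (t : ℝ) :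
    t * deriv (logWeight n) t + logWeight n t = (logMass n)⁻¹ * deriv (cutoff n) t := by
  have e : (fun t => t * logWeight n t) = fun t => (logMass n)⁻¹ * cutoff n t := by
    ext t
    rcases eq_or_ne t 0 with rfl | ht
    · simp [cutoff_of_le hn (inv_nonneg.2 hn.le)]
    · rw [logWeight]
      field_simp
  have h1 : HasDerivAt (fun t => t * logWeight n t) _ t := (hasDerivAt_id t).mul
    ((contDiff_logWeight hn).differentiable (by simp) t).hasDerivAt
  have h2 := ((contDiff_cutoff n).differentiable (by simp) t).hasDerivAt.const_mul (logMass n)⁻¹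
  rw [e] at h1
  have := h1.unique h2
  simp only [id_eq, one_mul] at this
  linarith

theorem isBump_logarithm (hn : 0 < n) (hI : 0 < logMass n) :
    IsBump (radialPrimitive (logWeight n)) :=
  isBump_radialPrimitive (contDiff_logWeight hn) (fun _ ht => logWeight_of_one_le hn ht)
    (integral_logWeight hI)

theorem hessianSchattenVariation_logarithm_le (hn : 2 ≤ n) (hI : 0 < logMass n) {p : ℝ≥0∞}
    (hp : 1 ≤ p) : hessianSchattenVariation p (radialPrimitive (logWeight n)) Set.univ ≤
      ENNReal.ofReal (Real.pi * (8 * (logMass n)⁻¹ + (2 : ℝ) ^ (p⁻¹).toReal * 2)) := by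
  have hn0 : 0 < n := by linarith
  have hw := contDiff_logWeight hn0
  have hw' := (contDiff_deriv_infty hw).continuous
  refine iSup₂_le fun F hF => ENNReal.ofReal_le_ofReal ?_
  rw [setIntegral_univ]
  refine (integral_mul_doubleDiv_le (contDiff_radialPrimitive hw)
    (B := fun t => 4 * |t * deriv (logWeight n) t + logWeight n t| +
      2 ^ (1 - ((ENNReal.conjExponent p)⁻¹).toReal) * (2 * logWeight n t)) ?_ ?_
      (fun M hM x => sum_hessian_radialPrimitive_le' hw (inv_pos.2 hn0)
        (fun t ht => logWeight_of_le hn0 ht) (logWeight_nonneg hn0 hI)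
        (one_le_conjExponent p) hM x) hF).trans ?_
  · have := hw.continuous
    fun_prop
  · intro t ht
    have h := logWeight_of_one_le hn0 ht
    simp [h, deriv_eq_zero_of_nonneg (logWeight_nonneg hn0 hI) h]
  · rw [toReal_inv_conjExponent hp, sub_sub_cancel]
    simp only [deriv_logWeight hn0]
    rw [intervalIntegral.integral_add, intervalIntegral.integral_const_mul,
      intervalIntegral.integral_const_mul, intervalIntegral.integral_const_mul,
      integral_logWeight hI]
    · simp only [abs_mul, intervalIntegral.integral_const_mul]
      rw [abs_of_pos (inv_pos.2 hI)]
      have := integral_abs_deriv_cutoff_le hn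
      have := inv_pos.2 hI
      gcongr ?_ * (?_ + ?_)
      · nlinarith
      · simp
    · exact (((intervalIntegrable_deriv (contDiff_cutoff n) 0 1).const_mul _).abs).const_mul _
    · exact ((hw.continuous.intervalIntegrable _ _).const_mul _).const_mul _

end Logarithm
section Cone

variable {n : ℝ}

theorem inv_two_sqrt_eq {t : ℝ} (ht : 0 ≤ t) : (2 * √t)⁻¹ = 2⁻¹ * t ^ (-(1 / 2) : ℝ) := by
  rw [mul_inv, Real.sqrt_eq_rpow, Real.rpow_neg ht]

theorem intervalIntegrable_inv_two_sqrt {t : ℝ} (ht : t ∈ Set.Icc (0 : ℝ) 1) :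
    IntervalIntegrable (fun s => (2 * √s)⁻¹) volume t 1 := by
  refine ((intervalIntegral.intervalIntegrable_rpow' (a := t) (b := 1)
    (by norm_num : (-1 : ℝ) < -(1 / 2))).const_mul 2⁻¹).congr fun s hs => ?_
  rw [Set.uIoc_of_le ht.2] at hs
  exact (inv_two_sqrt_eq (ht.1.trans hs.1.le)).symm

theorem integral_inv_two_sqrt {t : ℝ} (ht : t ∈ Set.Icc (0 : ℝ) 1) :
    ∫ s in t..1, (2 * √s)⁻¹ = 1 - √t := by
  have : ∫ s in t..1, (2 * √s)⁻¹ = ∫ s in t..1, 2⁻¹ * s ^ (-(1 / 2) : ℝ) := by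
    refine intervalIntegral.integral_congr fun s hs => ?_
    rw [Set.uIcc_of_le ht.2] at hs
    exact inv_two_sqrt_eq (ht.1.trans hs.1)
  rw [this, intervalIntegral.integral_const_mul, integral_rpow (Or.inl (by norm_num)),
    Real.sqrt_eq_rpow]
  norm_num
  ring

/-- Minus the derivative with respect to `t = |x|²` of a smoothed cut cone. -/
noncomputable def coneWeight (n t : ℝ) : ℝ := cutoff n t * (2 * √t)⁻¹

theorem contDiff_coneWeight (hn : 0 < n) : ContDiff ℝ ∞ (coneWeight n) :=
  contDiff_cutoff_mul_inv_sqrt hn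

theorem coneWeight_of_one_le (hn : 0 < n) {t : ℝ} (ht : 1 ≤ t) : coneWeight n t = 0 := by
  rw [coneWeight, cutoff_of_one_le hn ht, zero_mul]

theorem coneWeight_of_le (hn : 0 < n) {t : ℝ} (ht : t ≤ n⁻¹) : coneWeight n t = 0 := by
  rw [coneWeight, cutoff_of_le hn ht, zero_mul]

theorem coneWeight_nonneg (n t : ℝ) : 0 ≤ coneWeight n t :=
  mul_nonneg (cutoff_nonneg n t) (by positivity)

theorem coneWeight_le (n t : ℝ) : coneWeight n t ≤ (2 * √t)⁻¹ :=
  mul_le_of_le_one_left (by positivity) (cutoff_le_one n t)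

theorem integral_coneWeight_mem (hn : 0 < n) {t : ℝ} (ht : t ∈ Set.Icc (0 : ℝ) 1) :
    ∫ s in t..1, coneWeight n s ∈ Set.Icc (0 : ℝ) 1 := by
  refine ⟨intervalIntegral.integral_nonneg ht.2 fun s _ => coneWeight_nonneg n s, ?_⟩
  calc _ ≤ ∫ s in t..1, (2 * √s)⁻¹ :=
        intervalIntegral.integral_mono_on ht.2
          ((contDiff_coneWeight hn).continuous.intervalIntegrable _ _)
          (intervalIntegrable_inv_two_sqrt ht) fun s _ => coneWeight_le n s
    _ ≤ 1 := by
        rw [integral_inv_two_sqrt ht]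
        linarith [Real.sqrt_nonneg t]

theorem deriv_coneWeight (hn : 0 < n) {t : ℝ} (ht : 0 < t) :
    4 * (t * deriv (coneWeight n) t) + 2 * coneWeight n t = 2 * √t * deriv (cutoff n) t := by
  have hs := Real.sqrt_pos.2 ht
  have e : cutoff n =ᶠ[𝓝 t] fun s => 2 * √s * coneWeight n s := by
    filter_upwards [lt_mem_nhds ht] with s hs
    have := Real.sqrt_pos.2 hs
    rw [coneWeight]
    field_simp
  have h1 := ((Real.hasDerivAt_sqrt ht.ne').const_mul 2).mul
    ((contDiff_coneWeight hn).differentiable (by simp) t).hasDerivAt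
  have h2 : deriv (cutoff n) t = _ := e.deriv_eq.trans h1.deriv
  rw [h2]
  have h3 := Real.mul_self_sqrt ht.le
  field_simp
  rw [Real.sq_sqrt ht.le]
  ring

theorem abs_deriv_coneWeight_le (hn : 0 < n) {t : ℝ} (ht : t ∈ Set.Icc (0 : ℝ) 1) :
    |4 * (t * deriv (coneWeight n) t) + 2 * coneWeight n t| ≤
      2 * √(2 / n) * deriv (fun t => Real.smoothTransition (n * t - 1)) t -
        2 * deriv (fun t => Real.smoothTransition (n * (1 - t))) t := by
  have hl := deriv_cutoff_left_nonneg hn t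
  have hr := deriv_cutoff_right_nonpos hn t
  rcases ht.1.eq_or_lt with rfl | ht0
  · simp only [zero_mul, mul_zero, zero_add, coneWeight_of_le hn (inv_nonneg.2 hn.le), abs_zero]
    have : 0 ≤ 2 * √(2 / n) * deriv (fun t => Real.smoothTransition (n * t - 1)) 0 := by
      positivity
    linarith
  · have h1 : √t ≤ 1 := Real.sqrt_le_one.2 ht.2
    have h2 : √t * deriv (fun t => Real.smoothTransition (n * t - 1)) t ≤
        √(2 / n) * deriv (fun t => Real.smoothTransition (n * t - 1)) t := by
      rcases lt_or_ge (2 / n) t with h | h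
      · rw [deriv_cutoff_left_of_gt hn h]; simp
      · gcongr
    rw [deriv_coneWeight hn ht0, abs_mul, abs_of_nonneg (by positivity : 0 ≤ 2 * √t)]
    have h3 := mul_le_mul_of_nonneg_left (abs_deriv_cutoff_le hn t) (Real.sqrt_nonneg t)
    nlinarith [Real.sqrt_nonneg t]

theorem integral_coneProfile_le (hn : 2 ≤ n) :
    ∫ t in (0 : ℝ)..1, (|4 * (t * deriv (coneWeight n) t) + 2 * coneWeight n t| +
      2 * coneWeight n t) ≤ 2 * √(2 / n) + 4 := by
  have hn0 : 0 < n := by linarith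
  have hw := (contDiff_coneWeight hn0).continuous
  have hw' := (contDiff_deriv_infty (contDiff_coneWeight hn0)).continuous
  have hl := intervalIntegrable_deriv (contDiff_cutoff_left n) 0 1
  have hr := intervalIntegrable_deriv (contDiff_cutoff_right n) 0 1
  have hi : IntervalIntegrable (fun t =>
      |4 * (t * deriv (coneWeight n) t) + 2 * coneWeight n t|) volume 0 1 :=
    Continuous.intervalIntegrable (by fun_prop) _ _
  have h1 := intervalIntegral.integral_mono_on zero_le_one hi
    ((hl.const_mul (2 * √(2 / n))).sub (hr.const_mul 2)) fun t ht => abs_deriv_coneWeight_le hn0 ht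
  rw [intervalIntegral.integral_sub (hl.const_mul _) (hr.const_mul _),
    intervalIntegral.integral_const_mul, intervalIntegral.integral_const_mul,
    integral_deriv_cutoff_left hn, integral_deriv_cutoff_right hn] at h1
  rw [intervalIntegral.integral_add hi ((hw.intervalIntegrable _ _).const_mul _),
    intervalIntegral.integral_const_mul]
  have h2 := (integral_coneWeight_mem hn0 (t := 0) (by simp)).2
  linarith

theorem integral_coneApprox_le (hn : 2 ≤ n) {q : ℝ≥0∞} (hq : 1 ≤ q)
    {A : Set (EuclideanSpace ℝ (Fin 2))} {F : EuclideanSpace ℝ (Fin 2) → Matrix (Fin 2) (Fin 2) ℝ}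
    (hF : IsTestField q A F) :
    ∫ x, radialPrimitive (coneWeight n) x * doubleDiv F x ≤
      Real.pi * (2 * √(2 / n) + 4) := by
  have hn0 : 0 < n := by linarith
  have hw := contDiff_coneWeight hn0
  have hw' := (contDiff_deriv_infty hw).continuous
  refine (integral_mul_doubleDiv_le (contDiff_radialPrimitive hw)
    (B := fun t => |4 * (t * deriv (coneWeight n) t) + 2 * coneWeight n t| +
      2 * coneWeight n t) ?_ ?_ (fun M hM x => sum_hessian_radialPrimitive_le hw (inv_pos.2 hn0)
        (fun t ht => coneWeight_of_le hn0 ht) (coneWeight_nonneg n) hq hM x) hF).trans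
      (mul_le_mul_of_nonneg_left (integral_coneProfile_le hn) Real.pi_pos.le)
  · have := hw.continuous
    fun_prop
  · intro t ht
    have h := coneWeight_of_one_le hn0 ht
    simp [h, deriv_eq_zero_of_nonneg (coneWeight_nonneg n) h]

theorem tendsto_radialPrimitive_coneWeight (x : EuclideanSpace ℝ (Fin 2)) :
    Tendsto (fun n => radialPrimitive (coneWeight n) x) atTop (𝓝 (cutCone x)) := by
  rcases le_total 1 ‖x‖ with hx | hx
  · have : cutCone x = 0 := max_eq_right (by linarith)
    rw [this]
    refine tendsto_const_nhds.congr' ?_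
    filter_upwards [eventually_gt_atTop 0] with n hn
    exact (radialPrimitive_of_one_le (fun t ht => coneWeight_of_one_le hn ht) hx).symm
  · have ht : ‖x‖ ^ 2 ∈ Set.Icc (0 : ℝ) 1 := ⟨by positivity, pow_le_one₀ (norm_nonneg x) hx⟩
    have : cutCone x = ∫ s in ‖x‖ ^ 2..1, (2 * √s)⁻¹ := by
      rw [integral_inv_two_sqrt ht, Real.sqrt_sq (norm_nonneg x), cutCone,
        max_eq_left (by linarith)]
    rw [this]
    refine intervalIntegral.tendsto_integral_filter_of_dominated_convergence
      (fun s => (2 * √s)⁻¹) ?_ ?_ (intervalIntegrable_inv_two_sqrt ht) ?_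
    · filter_upwards [eventually_gt_atTop 0] with n hn
      exact (contDiff_coneWeight hn).continuous.aestronglyMeasurable
    · refine Eventually.of_forall fun n => Eventually.of_forall fun s _ => ?_
      rw [Real.norm_eq_abs, abs_of_nonneg (coneWeight_nonneg n s)]
      exact coneWeight_le n s
    · have h1 : ∀ᵐ s : ℝ, s ≠ 1 := by simp [ae_iff]
      filter_upwards [h1] with s hs1 hs
      rw [Set.uIoc_of_le ht.2] at hs
      have hs0 : 0 < s := ht.1.trans_lt hs.1
      have hs1' : 0 < 1 - s := sub_pos.2 (lt_of_le_of_ne hs.2 hs1)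
      refine tendsto_const_nhds.congr' ?_
      filter_upwards [eventually_ge_atTop (2 / s), eventually_ge_atTop (1 / (1 - s))] with n h2 h3
      rw [coneWeight, cutoff_eq_one ((div_le_iff₀ hs0).1 h2) ((div_le_iff₀ hs1').1 h3), one_mul]

theorem abs_radialPrimitive_coneWeight_le (hn : 0 < n) (x : EuclideanSpace ℝ (Fin 2)) :
    |radialPrimitive (coneWeight n) x| ≤ 1 := by
  rcases le_total 1 ‖x‖ with hx | hx
  · rw [radialPrimitive_of_one_le (fun t ht => coneWeight_of_one_le hn ht) hx]
    simp
  · have h := integral_coneWeight_mem hn (t := ‖x‖ ^ 2)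
      ⟨by positivity, pow_le_one₀ (norm_nonneg x) hx⟩
    rw [radialPrimitive, abs_of_nonneg h.1]
    exact h.2

theorem IsTestField.integrable_doubleDiv {d : ℕ} {q : ℝ≥0∞} {A : Set (EuclideanSpace ℝ (Fin d))}
    {F : EuclideanSpace ℝ (Fin d) → Matrix (Fin d) (Fin d) ℝ} (hF : IsTestField q A F) :
    Integrable (doubleDiv F) :=
  integrable_finsetSum _ fun i _ => integrable_finsetSum _ fun j _ =>
    (contDiff_partialDeriv (contDiff_partialDeriv (hF.smooth i j) j)
      i).continuous.integrable_of_hasCompactSupport (hasCompactSupport_partialDeriv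
        (hasCompactSupport_partialDeriv (hF.compactSupport i j) j) i)

theorem hessianSchattenVariation_cutCone_le :
    hessianSchattenVariation 1 cutCone Set.univ ≤ ENNReal.ofReal (4 * Real.pi) := by
  refine iSup₂_le fun F hF => ENNReal.ofReal_le_ofReal ?_
  rw [setIntegral_univ]
  have hint := hF.integrable_doubleDiv
  have h1 : Tendsto (fun n => ∫ x, radialPrimitive (coneWeight n) x * doubleDiv F x) atTop
      (𝓝 (∫ x, cutCone x * doubleDiv F x)) := by
    refine tendsto_integral_filter_of_dominated_convergence (fun x => |doubleDiv F x|) ?_ ?_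
      hint.abs (Eventually.of_forall fun x =>
        (tendsto_radialPrimitive_coneWeight x).mul_const _)
    · filter_upwards [eventually_gt_atTop 0] with n hn
      exact (contDiff_radialPrimitive
        (contDiff_coneWeight hn)).continuous.aestronglyMeasurable.mul hint.aestronglyMeasurable
    · filter_upwards [eventually_gt_atTop 0] with n hn
      refine Eventually.of_forall fun x => ?_
      rw [Real.norm_eq_abs, abs_mul]
      exact mul_le_of_le_one_left (abs_nonneg _) (abs_radialPrimitive_coneWeight_le hn x)
  have h2 : Tendsto (fun n : ℝ => Real.pi * (2 * √(2 / n) + 4)) atTop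
      (𝓝 (Real.pi * (2 * √0 + 4))) :=
    ((((Real.continuous_sqrt.tendsto 0).comp (tendsto_id.const_div_atTop 2)).const_mul 2).add_const
      4).const_mul _
  rw [Real.sqrt_zero, mul_zero, zero_add, mul_comm] at h2
  refine le_of_tendsto_of_tendsto h1 h2 ?_
  filter_upwards [eventually_ge_atTop 2] with n hn
  exact integral_coneApprox_le hn (one_le_conjExponent 1) hF

theorem hessianSchattenVariation_cutCone :
    hessianSchattenVariation 1 cutCone Set.univ = ENNReal.ofReal (4 * Real.pi) := by
  refine le_antisymm hessianSchattenVariation_cutCone_le ?_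
  have h : (4 : ℝ) = 2 ^ (1 + ((1 : ℝ≥0∞)⁻¹).toReal) := by norm_num
  rw [h]
  exact isBump_cutCone.le_hessianSchattenVariation le_rfl

end Cone

theorem iInf_hessianSchattenVariation_le {p : ℝ≥0∞} (hp : 1 ≤ p) :
    ⨅ (f : EuclideanSpace ℝ (Fin 2) → ℝ) (_ : IsBump f), hessianSchattenVariation p f Set.univ ≤
      ENNReal.ofReal ((2 : ℝ) ^ (1 + (p⁻¹).toReal) * Real.pi) := by
  have hlog : Tendsto (fun n : ℝ => Real.log (n / 4)) atTop atTop :=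
    Real.tendsto_log_atTop.comp (tendsto_id.atTop_div_const (by norm_num))
  have hI : Tendsto logMass atTop atTop := by
    refine tendsto_atTop_mono' _ ?_ hlog
    filter_upwards [eventually_ge_atTop 4] with n hn using log_le_logMass hn
  have h := (((tendsto_inv_atTop_zero.comp hI).const_mul 8).add_const
    ((2 : ℝ) ^ (p⁻¹).toReal * 2)).const_mul Real.pi
  have e : Real.pi * (8 * 0 + (2 : ℝ) ^ (p⁻¹).toReal * 2) =
      (2 : ℝ) ^ (1 + (p⁻¹).toReal) * Real.pi := by
    rw [Real.rpow_add two_pos, Real.rpow_one]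
    ring
  rw [e] at h
  refine ge_of_tendsto (ENNReal.tendsto_ofReal h) ?_
  filter_upwards [eventually_ge_atTop 2, hI.eventually_gt_atTop 0] with n hn hn'
  exact (iInf₂_le _ (isBump_logarithm (by linarith) hn')).trans
    (hessianSchattenVariation_logarithm_le hn hn' hp)

end HessianSchatten

theorem lemma4p3 :
    (∀ p : ℝ≥0∞, 1 ≤ p →
      (⨅ (f : EuclideanSpace ℝ (Fin 2) → ℝ) (_ : HessianSchatten.IsBump f),
          HessianSchatten.hessianSchattenVariation p f Set.univ) =
        ENNReal.ofReal ((2 : ℝ) ^ (1 + (p⁻¹).toReal) * Real.pi)) ∧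
    (HessianSchatten.IsBump HessianSchatten.cutCone ∧
      HessianSchatten.hessianSchattenVariation 1 HessianSchatten.cutCone Set.univ =
        ENNReal.ofReal (4 * Real.pi)) :=
  ⟨fun _ hp => le_antisymm (HessianSchatten.iInf_hessianSchattenVariation_le hp)
    (le_iInf₂ fun _ hf => hf.le_hessianSchattenVariation hp),
    HessianSchatten.isBump_cutCone, HessianSchatten.hessianSchattenVariation_cutCone⟩
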